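/- Let $N$ be a closed (compact, without boundary) smooth $n$-manifold, let $\operatorname{Diff}(N)$ be its group of smooth diffeomorphisms, let $\Gamma \le \operatorname{Diff}(N)$ be a subgroup, let $\mu$ be a regular Borel probability measure on $N$ and let $g$ be a (smooth) Riemannian metric on $N$. **Notation.** For a finite-dimensional real vector space $V$, let $\mathcal P(V)$ be the set of inner products on $V$, with the Riemannian distance of the invariant metric $\langle A,B\rangle_P=\operatorname{Tr}(P^{-1}AP^{-1}B)$. Let $\operatorname{Riem}(N)$ be the continuous field of metric spaces over $N$ with fibers $\mathcal P(T_zN)$, whose continuous sections are the continuous fields of inner products on the tangent spaces. $\operatorname{Diff}(N)$ acts isometrically on it by pushforward, $(\varphi_*s)_z=(D_z\varphi^{-1})^*\,s_{\varphi^{-1}(z)}$; we write $\gamma(g)=\gamma_*g$. A section of $\operatorname{Riem}(N)$ is measurable if its pointwise distance to every continuous section is measurable. For $\nu\in\operatorname{Prob}(N)$, $L^2(N,\nu,\operatorname{Riem}(N))$ is the set of measurable sections $s$ with $\int_N d(s(z),s_0(z))^2\,d\nu(z)<\infty$ for some continuous section $s_0$, modulo equality $\nu$-almost everywhere, with the distance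 $d(s,t)=\left(\int_N d(s(z),t(z))^2\,d\nu(z)\right)^{1/2}$. For $Y\subseteq\operatorname{Prob}(N)$ (weak topology), $\operatorname{Riem}(N)|_Y$ is the continuous field over $Y$ with fiber $L^2(N,\nu,\operatorname{Riem}(N))$ at $\nu$, whose continuous sections are those sections $S$ for which $\nu\mapsto d(S(\nu),s)$ is continuous on $Y$ for each continuous section $s$ of $\operatorname{Riem}(N)$ (regarded as a point of each $L^2(N,\nu,\operatorname{Riem}(N))$). If $Y$ is $\Gamma$-invariant, then $\Gamma$ acts on $\operatorname{Riem}(N)|_Y$, an element $\gamma$ sending a section $S$ to the section $\gamma S$ with $(\gamma S)(\nu)=\gamma_*\big(S((\gamma^{-1})_*\nu)\big)$. This action is *metrically proper* if for every continuous section $S$ of $\operatorname{Riem}(N)|_Y$ and every $R$, only finitely many $\gamma\in\Gamma$ satisfy $\inf_{\nu\in Y}d(S(\nu),(\gamma S)(\nu))<R$. For $\nu\in\operatorname{Prob}(N)$ and $\varphi,\psi\in\operatorname{Diff}(N)$ put $$d_{\nu,g}(\varphi,\psi)=\left(\int_N\Big(\log\max\big\{\|D_{\varphi^{-1}(x)}(\psi^{-1}\varphi)\|_g,\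 \|D_{\psi^{-1}(x)}(\varphi^{-1}\psi)\|_g\big\}\Big)^2d\nu(x)\right)^{1/2},$$ where $\|\cdot\|_g$ is the operator norm with respect to $g$. $\Gamma$ is *$\mu$-discrete* if for every $R$ only finitely many $\gamma\in\Gamma$ satisfy $\inf_{\tau\in\Gamma}d_{\tau_*\mu,g}(\gamma,1)<R$. A map $f$ from a metric space $X$ to a metric space is a *coarse embedding* if there are nondecreasing functions $\rho_-,\rho_+\colon[0,\infty)\to[0,\infty)$ with $\rho_-(r)\to\infty$ as $r\to\infty$ and $\rho_-(d(x,x'))\le d(f(x),f(x'))\le\rho_+(d(x,x'))$ for all $x,x'\in X$. A map defined on a group $\Gamma$ is a coarse embedding if $\Gamma$ has a left-invariant metric with finite balls (equivalently, $\Gamma$ is countable) and the map is a coarse embedding for every such metric on $\Gamma$. **Proposition.** The orbit closure $\overline{\Gamma\cdot\mu}$ and the closed convex hull $\overline{\operatorname{convex}(\Gamma\cdot\mu)}$ in $\operatorname{Prob}(N)$ are $\Gamma$-invariant, and the following are equivalent: 1. $\Gamma$ is $\mu$-discrete; 2. the action of $\Gamma$ on $\operatorname{Riem}(N)|_{\overline{\Gamma\cdot\mu}}$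 is metrically proper; 3. the action of $\Gamma$ on $\operatorname{Riem}(N)|_{\overline{\operatorname{convex}(\Gamma\cdot\mu)}}$ is metrically proper; 4. the map $\Gamma\to L^2(N,\mu,\operatorname{Riem}(N))$, $\gamma\mapsto\gamma(g)$, is a coarse embedding. -/

import Mathlib

open MeasureTheory Set Filter
open scoped ENNReal NNReal Topology Manifold ContDiff
namespace RiemField

/-- The set `𝒫(V)` of inner products on a real vector space `V`. -/
structure InnerProd (V : Type*) [AddCommGroup V] [Module ℝ V] where
  form : LinearMap.BilinForm ℝ V
  symm : ∀ v w, form v w = form w v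
  pos : ∀ v, v ≠ 0 → 0 < form v v

namespace InnerProd

variable {V W : Type*} [AddCommGroup V] [Module ℝ V] [AddCommGroup W] [Module ℝ W]

theorem ext' {P Q : InnerProd V} (h : ∀ v w, P.form v w = Q.form v w) : P = Q := by
  cases P; cases Q
  congr
  exact LinearMap.ext₂ h

theorem nondegenerate (P : InnerProd V) : P.form.Nondegenerate := by
  refine ⟨fun v hv => ?_, fun v hv => ?_⟩ <;>
  · by_contra h
    exact (P.pos v h).ne' (hv v)

/-- The pullback `T^* P = P ∘ (T × T)` of an inner product along a linear isomorphism. -/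
def pullback (T : V ≃ₗ[ℝ] W) (P : InnerProd W) : InnerProd V where
  form := P.form.compl₁₂ T.toLinearMap T.toLinearMap
  symm v w := by simpa using P.symm (T v) (T w)
  pos v hv := by simpa using P.pos (T v) (by simpa using hv)

@[simp] theorem pullback_apply (T : V ≃ₗ[ℝ] W) (P : InnerProd W) (v w : V) :
    (pullback T P).form v w = P.form (T v) (T w) := by
  simp [pullback]

/-- The squared length `Tr (P⁻¹ A P⁻¹ A)` of a tangent vector `A` (a bilinear form) to the
symmetric space `𝒫(V)` at the point `P`; here `P⁻¹ A` is the endomorphism `L` of `V` with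
`P (L v, w) = A (v, w)`. At the standard inner product of `ℝⁿ` this is `Tr (A A)`. -/
noncomputable def normSq [FiniteDimensional ℝ V] (P : InnerProd V)
    (A : LinearMap.BilinForm ℝ V) : ℝ :=
  LinearMap.trace ℝ V
    (A.symmCompOfNondegenerate P.form P.nondegenerate ∘ₗ
      A.symmCompOfNondegenerate P.form P.nondegenerate)

/-- Piecewise continuously differentiable paths `[0,1] → 𝒫(V)` from `P` to `Q`, with finitely many
break points. (Only the values at times in `[0,1]` matter.) -/
structure Path (P Q : InnerProd V) where
  toFun : ℝ → InnerProd V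
  velocity : ℝ → LinearMap.BilinForm ℝ V
  breaks : Finset ℝ
  source : toFun 0 = P
  target : toFun 1 = Q
  contDiffOn : ∀ a b : ℝ, 0 ≤ a → a < b → b ≤ 1 → Disjoint (Ioo a b) (breaks : Set ℝ) →
    ∀ v w, ContDiffOn ℝ 1 (fun t => (toFun t).form v w) (Icc a b)
  hasDerivAt : ∀ t ∈ Ioo (0 : ℝ) 1, t ∉ breaks →
    ∀ v w, HasDerivAt (fun t => (toFun t).form v w) (velocity t v w) t

/-- The Riemannian length of a path. -/
noncomputable def Path.length [FiniteDimensional ℝ V] {P Q : InnerProd V} (c : Path P Q) : ℝ≥0∞ :=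
  ∫⁻ t in Ioo (0 : ℝ) 1, ENNReal.ofReal (Real.sqrt (normSq (c.toFun t) (c.velocity t)))

/-- The standard metric on the symmetric space `𝒫(V) ≅ GL(n,ℝ)/O(n)`: the Riemannian distance of
the invariant Riemannian metric `⟨A, B⟩_P = Tr (P⁻¹ A P⁻¹ B)`. -/
noncomputable instance [FiniteDimensional ℝ V] : EDist (InnerProd V) :=
  ⟨fun P Q => ⨅ c : Path P Q, c.length⟩

theorem edist_def [FiniteDimensional ℝ V] (P Q : InnerProd V) :
    edist P Q = ⨅ c : Path P Q, c.length := rfl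

theorem symmComp_apply [FiniteDimensional ℝ V] (P : InnerProd V) (A : LinearMap.BilinForm ℝ V)
    (v w : V) : P.form (A.symmCompOfNondegenerate P.form P.nondegenerate v) w = A v w :=
  LinearMap.BilinForm.symmCompOfNondegenerate_left_apply A P.nondegenerate w v

/-- Invariance of the Riemannian metric under linear isomorphisms. -/
theorem normSq_pullback [FiniteDimensional ℝ V] [FiniteDimensional ℝ W] (T : V ≃ₗ[ℝ] W)
    (P : InnerProd W) (A : LinearMap.BilinForm ℝ W) :
    normSq (pullback T P) (A.compl₁₂ T.toLinearMap T.toLinearMap) = normSq P A := by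
  set L := A.symmCompOfNondegenerate P.form P.nondegenerate with hL
  have key : LinearMap.BilinForm.symmCompOfNondegenerate
      (A.compl₁₂ T.toLinearMap T.toLinearMap)
      (pullback T P).form (pullback T P).nondegenerate = T.symm.conj L := by
    symm
    refine LinearMap.ext fun v => ?_
    rw [← sub_eq_zero]
    by_contra h
    refine ((pullback T P).pos _ h).ne' ?_
    have h2 : ∀ w, (pullback T P).form ((T.symm.conj L) v) w
      = (A.compl₁₂ T.toLinearMap T.toLinearMap) v w := by
      intro w
      simp [LinearEquiv.conj_apply, hL]
    rw [LinearMap.map_sub₂, h2, symmComp_apply, sub_self]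
  unfold normSq
  rw [key, ← hL, ← LinearEquiv.conj_comp, LinearMap.trace_conj']

theorem edist_pullback_le [FiniteDimensional ℝ V] [FiniteDimensional ℝ W] (T : V ≃ₗ[ℝ] W)
    (P Q : InnerProd W) : edist (pullback T P) (pullback T Q) ≤ edist P Q := by
  refine le_iInf fun c => ?_
  let c' : Path (pullback T P) (pullback T Q) :=
    { toFun := fun t => pullback T (c.toFun t)
      velocity := fun t => (c.velocity t).compl₁₂ T.toLinearMap T.toLinearMap
      breaks := c.breaks
      source := by rw [c.source]
      target := by rw [c.target]
      contDiffOn := fun a b ha hab hb h v w => by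
        simpa using c.contDiffOn a b ha hab hb h (T v) (T w)
      hasDerivAt := fun t ht h v w => by
        simpa using c.hasDerivAt t ht h (T v) (T w) }
  refine (iInf_le _ c').trans (le_of_eq ?_)
  simp only [Path.length, c', normSq_pullback]

theorem edist_pullback [FiniteDimensional ℝ V] [FiniteDimensional ℝ W] (T : V ≃ₗ[ℝ] W)
    (P Q : InnerProd W) : edist (pullback T P) (pullback T Q) = edist P Q := by
  refine le_antisymm (edist_pullback_le T P Q) ?_
  have h : ∀ R : InnerProd W, pullback T.symm (pullback T R) = R := fun R =>
    ext' fun v w => by simp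
  simpa only [h] using edist_pullback_le T.symm (pullback T P) (pullback T Q)

theorem edist_self' [FiniteDimensional ℝ V] (P : InnerProd V) : edist P P = 0 := by
  refine le_antisymm ?_ zero_le
  let c : Path P P :=
    { toFun := fun _ => P
      velocity := fun _ => 0
      breaks := ∅
      source := rfl
      target := rfl
      contDiffOn := fun _ _ _ _ _ _ _ _ => contDiffOn_const
      hasDerivAt := fun t _ _ v w => by simpa using hasDerivAt_const t (P.form v w) }
  refine (iInf_le _ c).trans (le_of_eq ?_)
  have h0 : normSq P 0 = 0 := by
    have : LinearMap.BilinForm.symmCompOfNondegenerate 0 P.form P.nondegenerate = 0 := by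
      simp [LinearMap.BilinForm.symmCompOfNondegenerate]
    simp [normSq, this]
  simp [Path.length, c, h0]

theorem normSq_smul [FiniteDimensional ℝ V] (P : InnerProd V) (A : LinearMap.BilinForm ℝ V)
    (r : ℝ) : normSq P (r • A) = r ^ 2 * normSq P A := by
  have : LinearMap.BilinForm.symmCompOfNondegenerate (r • A) P.form P.nondegenerate
      = r • LinearMap.BilinForm.symmCompOfNondegenerate A P.form P.nondegenerate := by
    ext v
    simp [LinearMap.BilinForm.symmCompOfNondegenerate]
  simp only [normSq, this, LinearMap.smul_comp, LinearMap.comp_smul, map_smul, smul_eq_mul]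
  ring

theorem sqrt_normSq_smul [FiniteDimensional ℝ V] (P : InnerProd V) (A : LinearMap.BilinForm ℝ V)
    (r : ℝ) : Real.sqrt (normSq P (r • A)) = |r| * Real.sqrt (normSq P A) := by
  rw [normSq_smul, Real.sqrt_mul (sq_nonneg r), Real.sqrt_sq_eq_abs]

theorem edist_comm_le [FiniteDimensional ℝ V] (P Q : InnerProd V) : edist P Q ≤ edist Q P := by
  refine le_iInf fun c => ?_
  let c' : Path P Q :=
    { toFun := fun t => c.toFun (1 - t)
      velocity := fun t => (-1 : ℝ) • c.velocity (1 - t)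
      breaks := c.breaks.image (fun t => 1 - t)
      source := by simpa using c.target
      target := by simpa using c.source
      contDiffOn := fun a b ha hab hb h v w => by
        have h1 := c.contDiffOn (1 - b) (1 - a) (by linarith) (by linarith) (by linarith) (by
          rw [Set.disjoint_left] at h ⊢
          intro t ht hb
          refine h (a := 1 - t) ⟨by linarith [ht.2], by linarith [ht.1]⟩ ?_
          simpa using hb) v w
        exact h1.comp (contDiff_const.sub contDiff_id).contDiffOn
          (fun t ht => ⟨by simp; linarith [ht.2], by simp; linarith [ht.1]⟩)
      hasDerivAt := fun t ht h v w => by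
        have h1 := c.hasDerivAt (1 - t) ⟨by linarith [ht.2], by linarith [ht.1]⟩ (by
          intro hb; exact h (Finset.mem_image.2 ⟨_, hb, by ring⟩)) v w
        have h2 : HasDerivAt (fun t : ℝ => 1 - t) (-1) t := by
          simpa using (hasDerivAt_id t).const_sub 1
        simpa [Function.comp_def] using h1.comp t h2 }
  refine (iInf_le _ c').trans (le_of_eq ?_)
  simp only [Path.length, c', sqrt_normSq_smul, abs_neg, abs_one, one_mul]
  have hm : MeasurePreserving (fun t : ℝ => 1 - t) volume volume :=
    Measure.measurePreserving_sub_left volume 1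
  have he : MeasurableEmbedding (fun t : ℝ => 1 - t) :=
    (Homeomorph.subLeft (1 : ℝ)).measurableEmbedding
  have := hm.setLIntegral_comp_preimage_emb he
    (fun t => ENNReal.ofReal (Real.sqrt (normSq (c.toFun t) (c.velocity t)))) (Ioo (0 : ℝ) 1)
  rw [← this]
  simp

/-- Concatenation of paths. -/
theorem edist_triangle' [FiniteDimensional ℝ V] (P Q R : InnerProd V) :
    edist P R ≤ edist P Q + edist Q R := by
  rw [edist_def P Q, edist_def Q R, ENNReal.iInf_add]
  refine le_iInf fun p => ?_
  rw [ENNReal.add_iInf]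
  refine le_iInf fun q => ?_
  let c : Path P R :=
    { toFun := fun t => if t ≤ 1 / 2 then p.toFun (2 * t) else q.toFun (2 * t - 1)
      velocity := fun t => if t ≤ 1 / 2 then (2 : ℝ) • p.velocity (2 * t)
        else (2 : ℝ) • q.velocity (2 * t - 1)
      breaks := insert (1 / 2) (p.breaks.image (fun t => t / 2) ∪
        q.breaks.image (fun t => (t + 1) / 2))
      source := by simpa using p.source
      target := by
        rw [if_neg (by norm_num)]
        norm_num
        exact q.target
      contDiffOn := fun a b ha hab hb h v w => by
        rw [Set.disjoint_left] at h
        have hcase : b ≤ 1 / 2 ∨ 1 / 2 ≤ a := by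
          by_contra! hh
          exact h (a := 1 / 2) ⟨hh.2, hh.1⟩ (by simp)
        rcases hcase with hb2 | ha2
        · have h1 := p.contDiffOn (2 * a) (2 * b) (by linarith) (by linarith) (by linarith) (by
            rw [Set.disjoint_left]
            intro t ht htb
            refine h (a := t / 2) ⟨by linarith [ht.1], by linarith [ht.2]⟩ ?_
            exact Finset.mem_insert_of_mem (Finset.mem_union_left _
              (Finset.mem_image_of_mem _ htb))) v w
          refine (h1.comp (contDiff_const.mul contDiff_id).contDiffOn
            (s := Icc a b) (g := fun t => (p.toFun t).form v w) (f := fun t : ℝ => 2 * t)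
            (fun t ht => ⟨?_, ?_⟩)).congr (fun t ht => ?_)
          · simp; linarith [ht.1]
          · simp; linarith [ht.2]
          · rw [if_pos (by linarith [ht.2])]; rfl
        · have h1 := q.contDiffOn (2 * a - 1) (2 * b - 1) (by linarith) (by linarith)
            (by linarith) (by
              rw [Set.disjoint_left]
              intro t ht htb
              refine h (a := (t + 1) / 2) ⟨by linarith [ht.1], by linarith [ht.2]⟩ ?_
              exact Finset.mem_insert_of_mem (Finset.mem_union_right _
                (Finset.mem_image_of_mem _ htb))) v w
          refine (h1.comp ((contDiff_const.mul contDiff_id).sub contDiff_const).contDiffOn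
            (s := Icc a b) (g := fun t => (q.toFun t).form v w) (f := fun t : ℝ => 2 * t - 1)
            (fun t ht => ⟨?_, ?_⟩)).congr (fun t ht => ?_)
          · simp; linarith [ht.1]
          · simp; linarith [ht.2]
          · by_cases h2 : t ≤ 1 / 2
            · have : t = 1 / 2 := le_antisymm h2 (ha2.trans ht.1)
              subst this
              norm_num
              rw [p.target, q.source]
            · rw [if_neg h2]; rfl
      hasDerivAt := fun t ht h v w => by
        have hne : t ≠ 1 / 2 := fun hh => h (by rw [hh]; exact Finset.mem_insert_self _ _)
        rcases lt_or_gt_of_ne hne with hlt | hgt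
        · have h1 := p.hasDerivAt (2 * t) ⟨by linarith [ht.1], by linarith⟩ (fun hb => h
            (Finset.mem_insert_of_mem (Finset.mem_union_left _
              (Finset.mem_image.2 ⟨_, hb, by ring⟩)))) v w
          have h2 : HasDerivAt (fun t : ℝ => 2 * t) 2 t := by
            simpa using (hasDerivAt_id t).const_mul (2 : ℝ)
          have h3 := h1.comp t h2
          rw [if_pos hlt.le]
          refine (HasDerivAt.congr_of_eventuallyEq (h3.congr_deriv ?_) ?_)
          · simp [mul_comm]
          · filter_upwards [Iio_mem_nhds hlt] with τ hτ
            rw [if_pos (le_of_lt hτ)]; rfl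
        · have h1 := q.hasDerivAt (2 * t - 1) ⟨by linarith, by linarith [ht.2]⟩ (fun hb => h
            (Finset.mem_insert_of_mem (Finset.mem_union_right _
              (Finset.mem_image.2 ⟨_, hb, by ring⟩)))) v w
          have h2 : HasDerivAt (fun t : ℝ => 2 * t - 1) 2 t := by
            simpa using ((hasDerivAt_id t).const_mul (2 : ℝ)).sub_const 1
          have h3 := h1.comp t h2
          rw [if_neg (not_le.2 hgt)]
          refine (HasDerivAt.congr_of_eventuallyEq (h3.congr_deriv ?_) ?_)
          · simp [mul_comm]
          · filter_upwards [Ioi_mem_nhds hgt] with τ hτ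
            rw [if_neg (not_le.2 hτ)]; rfl }
  refine (iInf_le _ c).trans ?_
  set F : ℝ → ℝ≥0∞ := fun t => ENNReal.ofReal (Real.sqrt (normSq (p.toFun t) (p.velocity t)))
    with hF
  set G : ℝ → ℝ≥0∞ := fun t => ENNReal.ofReal (Real.sqrt (normSq (q.toFun t) (q.velocity t)))
    with hG
  have hscale : ∀ (H : ℝ → ℝ≥0∞) (a : ℝ) (s : Set ℝ),
      ∫⁻ t in (fun t => 2 * t + a) ⁻¹' s, 2 * H (2 * t + a) = ∫⁻ t in s, H t := by
    intro H a s
    have he : MeasurableEmbedding (fun t : ℝ => 2 * t + a) :=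
      (((Homeomorph.mulLeft₀ (2 : ℝ) two_ne_zero).trans
        (Homeomorph.addRight a))).measurableEmbedding
    have hmap : (volume : Measure ℝ) = (2 : ℝ≥0∞) • Measure.map (fun t : ℝ => 2 * t + a) volume := by
      have h1 : Measure.map (fun t : ℝ => 2 * t + a) volume
          = Measure.map (fun t : ℝ => t + a) (Measure.map (fun t : ℝ => 2 * t) volume) := by
        rw [Measure.map_map (by fun_prop) (by fun_prop)]; rfl
      rw [h1, Real.map_volume_mul_left two_ne_zero, Measure.map_smul, map_add_right_eq_self,
        smul_smul]
      have : (2 : ℝ≥0∞) * ENNReal.ofReal |(2 : ℝ)⁻¹| = 1 := by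
        rw [abs_of_pos (by norm_num), ENNReal.ofReal_inv_of_pos (by norm_num)]
        simpa using ENNReal.mul_inv_cancel (a := 2) (by norm_num) (by norm_num)
      rw [this, one_smul]
    rw [lintegral_const_mul' _ _ (by norm_num)]
    conv_rhs => rw [hmap]
    rw [Measure.restrict_smul, lintegral_smul_measure, he.restrict_map, he.lintegral_map]
    rfl
  have h1 : ∫⁻ t in Ioc (0 : ℝ) (1 / 2),
      ENNReal.ofReal (Real.sqrt (normSq (c.toFun t) (c.velocity t))) = p.length := by
    have := hscale F 0 (Ioc 0 1)
    have hset : (fun t : ℝ => 2 * t + 0) ⁻¹' (Ioc 0 1) = Ioc 0 (1 / 2) := by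
      ext t; simp only [mem_preimage, mem_Ioc]; constructor <;> intro h <;>
        constructor <;> linarith [h.1, h.2]
    rw [hset] at this
    unfold Path.length
    rw [setLIntegral_congr Ioo_ae_eq_Ioc, ← this]
    refine setLIntegral_congr_fun measurableSet_Ioc fun t ht => ?_
    simp only [c, if_pos ht.2, sqrt_normSq_smul, hF, add_zero]
    rw [ENNReal.ofReal_mul (by positivity)]
    simp
  have h2 : ∫⁻ t in Ioo (1 / 2 : ℝ) 1,
      ENNReal.ofReal (Real.sqrt (normSq (c.toFun t) (c.velocity t))) = q.length := by
    have := hscale G (-1) (Ioo 0 1)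
    have hset : (fun t : ℝ => 2 * t + -1) ⁻¹' (Ioo 0 1) = Ioo (1 / 2) 1 := by
      ext t; simp only [mem_preimage, mem_Ioo]; constructor <;> intro h <;>
        constructor <;> linarith [h.1, h.2]
    rw [hset] at this
    unfold Path.length
    rw [← this]
    refine setLIntegral_congr_fun measurableSet_Ioo fun t ht => ?_
    simp only [c, if_neg (not_le.2 ht.1), sqrt_normSq_smul, hG, ← sub_eq_add_neg]
    rw [ENNReal.ofReal_mul (by positivity)]
    simp
  rw [← h1, ← h2]
  unfold Path.length
  rw [← Ioc_union_Ioo_eq_Ioo (show (0 : ℝ) ≤ 1 / 2 by norm_num) (by norm_num : (1 / 2 : ℝ) < 1)]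
  exact lintegral_union_le _ _ _

noncomputable instance [FiniteDimensional ℝ V] : PseudoEMetricSpace (InnerProd V) where
  edist_self := edist_self'
  edist_comm P Q := le_antisymm (edist_comm_le P Q) (edist_comm_le Q P)
  edist_triangle := edist_triangle'

/-- An inner product as Mathlib's structure. -/
@[reducible] def toCore (P : InnerProd V) : InnerProductSpace.Core ℝ V where
  inner := fun v w => P.form v w
  conj_inner_symm := fun v w => P.symm w v
  re_inner_nonneg := fun v => by
    rcases eq_or_ne v 0 with rfl | hv
    · simp
    · simpa using (P.pos v hv).le
  add_left := fun v w x => by simp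
  smul_left := fun v w r => by simp
  definite := fun v hv => by
    by_contra h
    exact (P.pos v h).ne' hv

/-- A bound for the Riemannian metric in terms of a bound for a symmetric bilinear form. -/
theorem normSq_le [FiniteDimensional ℝ V] (P : InnerProd V) (A : LinearMap.BilinForm ℝ V)
    (hA : ∀ v w, A v w = A w v) {K : ℝ} (hK : 0 ≤ K)
    (h : ∀ v w, |A v w| ≤ K * Real.sqrt (P.form v v) * Real.sqrt (P.form w w)) :
    normSq P A ≤ Module.finrank ℝ V * K ^ 2 := by
  let core := P.toCore
  let _ : NormedAddCommGroup V := core.toNormedAddCommGroup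
  let _ : InnerProductSpace ℝ V := .ofCore core.toCore
  have hin : ∀ v w : V, inner ℝ v w = P.form v w := fun _ _ => rfl
  set L := A.symmCompOfNondegenerate P.form P.nondegenerate with hL
  have hL1 : ∀ v w, P.form (L v) w = A v w := symmComp_apply P A
  set e := stdOrthonormalBasis ℝ V
  have hn : normSq P A = ∑ i, P.form (L (e i)) (L (e i)) := by
    unfold normSq
    rw [← hL, LinearMap.trace_eq_sum_inner _ e]
    refine Finset.sum_congr rfl fun i _ => ?_
    rw [hin, P.symm, LinearMap.comp_apply, hL1, hA, hL1]
  rw [hn]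
  have hb : ∀ i, P.form (L (e i)) (L (e i)) ≤ K ^ 2 := by
    intro i
    set r := Real.sqrt (P.form (L (e i)) (L (e i))) with hr
    have hpos : 0 ≤ P.form (L (e i)) (L (e i)) := by
      rw [← hin]; exact real_inner_self_nonneg
    have h1 : P.form (L (e i)) (L (e i)) = r ^ 2 := (Real.sq_sqrt hpos).symm
    have h2 := h (e i) (L (e i))
    rw [← hL1, abs_of_nonneg hpos, ← hin (e i) (e i), real_inner_self_eq_norm_sq, e.norm_eq_one,
      ← hr, h1] at h2
    simp only [one_pow, Real.sqrt_one, mul_one] at h2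
    have hr0 : 0 ≤ r := Real.sqrt_nonneg _
    rw [h1]
    rcases hr0.eq_or_lt with h0 | h0
    · rw [← h0]; simpa using sq_nonneg K
    · have : r ≤ K := by nlinarith
      nlinarith
  calc ∑ i, P.form (L (e i)) (L (e i)) ≤ ∑ _i : Fin (Module.finrank ℝ V), K ^ 2 :=
        Finset.sum_le_sum fun i _ => hb i
    _ = _ := by simp

theorem nonneg (P : InnerProd V) (v : V) : 0 ≤ P.form v v := by
  rcases eq_or_ne v 0 with rfl | hv
  · simp
  · exact (P.pos v hv).le

/-- Close inner products (entrywise) have small distance. -/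
theorem edist_le_of_close [FiniteDimensional ℝ V] (P Q : InnerProd V) {K : ℝ} (hK : 0 ≤ K)
    (hK2 : K ≤ 1 / 2)
    (h : ∀ v w, |Q.form v w - P.form v w| ≤
      K * Real.sqrt (P.form v v) * Real.sqrt (P.form w w)) :
    edist P Q ≤ ENNReal.ofReal (Real.sqrt (Module.finrank ℝ V * (2 * K) ^ 2)) := by
  classical
  have hlow : ∀ t ∈ Icc (0 : ℝ) 1, ∀ v,
      1 / 2 * P.form v v ≤ ((1 - t) * P.form v v + t * Q.form v v) := by
    intro t ht v
    have h1 := h v v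
    rw [mul_assoc, Real.mul_self_sqrt (P.nonneg v)] at h1
    have h2 := (abs_le.1 h1).1
    have h3 := P.nonneg v
    have h4 : 1 / 2 * P.form v v ≤ Q.form v v := by nlinarith
    nlinarith [ht.1, ht.2]
  let R : ∀ t ∈ Icc (0 : ℝ) 1, InnerProd V := fun t ht =>
    { form := (1 - t) • P.form + t • Q.form
      symm := fun v w => by
        simp only [LinearMap.add_apply, LinearMap.smul_apply, P.symm v w, Q.symm v w]
      pos := fun v hv => by
        have := hlow t ht v
        have := P.pos v hv
        simp only [LinearMap.add_apply, LinearMap.smul_apply, smul_eq_mul]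
        linarith }
  let c : Path P Q :=
    { toFun := fun t => if ht : t ∈ Icc (0 : ℝ) 1 then R t ht else P
      velocity := fun _ => Q.form - P.form
      breaks := ∅
      source := by
        rw [dif_pos (by simp)]
        exact ext' fun v w => by simp [R]
      target := by
        rw [dif_pos (by simp)]
        exact ext' fun v w => by simp [R]
      contDiffOn := fun a b ha hab hb _ v w => by
        have : ContDiffOn ℝ 1 (fun t : ℝ => (1 - t) * P.form v w + t * Q.form v w) (Icc a b) := by
          fun_prop
        refine this.congr fun t ht => ?_
        rw [dif_pos ⟨ha.trans ht.1, ht.2.trans hb⟩]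
        simp [R]
      hasDerivAt := fun t ht _ v w => by
        have : HasDerivAt (fun t : ℝ => (1 - t) * P.form v w + t * Q.form v w)
            ((-1) * P.form v w + 1 * Q.form v w) t :=
          (((hasDerivAt_id t).const_sub 1).mul_const _).add ((hasDerivAt_id t).mul_const _)
        refine (this.congr_deriv ?_).congr_of_eventuallyEq ?_
        · simp; ring
        · filter_upwards [Ioo_mem_nhds ht.1 ht.2] with τ hτ
          rw [dif_pos (Ioo_subset_Icc_self hτ)]
          simp [R] }
  refine (iInf_le _ c).trans ?_
  have hbd : ∀ t ∈ Ioo (0 : ℝ) 1,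
      ENNReal.ofReal (Real.sqrt (normSq (c.toFun t) (c.velocity t))) ≤
        ENNReal.ofReal (Real.sqrt (Module.finrank ℝ V * (2 * K) ^ 2)) := by
    intro t ht
    have ht' := Ioo_subset_Icc_self ht
    refine ENNReal.ofReal_le_ofReal (Real.sqrt_le_sqrt (normSq_le _ _ ?_ (by positivity) ?_))
    · intro v w
      simp [c, P.symm v w, Q.symm v w]
    · intro v w
      have e1 : ∀ v, (c.toFun t).form v v = (1 - t) * P.form v v + t * Q.form v v := by
        intro v
        simp only [c]
        rw [dif_pos ht']
        simp [R]
      have e2 : ∀ v, Real.sqrt (P.form v v) ≤ Real.sqrt 2 * Real.sqrt ((c.toFun t).form v v) := by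
        intro v
        rw [← Real.sqrt_mul (by norm_num)]
        refine Real.sqrt_le_sqrt ?_
        rw [e1]
        linarith [hlow t ht' v]
      calc |c.velocity t v w| = |Q.form v w - P.form v w| := by simp [c]
        _ ≤ K * Real.sqrt (P.form v v) * Real.sqrt (P.form w w) := h v w
        _ ≤ K * (Real.sqrt 2 * Real.sqrt ((c.toFun t).form v v)) *
            (Real.sqrt 2 * Real.sqrt ((c.toFun t).form w w)) := by
          gcongr
          · exact e2 v
          · exact e2 w
        _ = 2 * K * Real.sqrt ((c.toFun t).form v v) * Real.sqrt ((c.toFun t).form w w) := by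
          have := Real.mul_self_sqrt (show (0 : ℝ) ≤ 2 by norm_num)
          linear_combination (K * Real.sqrt ((c.toFun t).form v v) *
            Real.sqrt ((c.toFun t).form w w)) * this
  calc c.length ≤ ∫⁻ _t in Ioo (0 : ℝ) 1,
        ENNReal.ofReal (Real.sqrt (Module.finrank ℝ V * (2 * K) ^ 2)) :=
        setLIntegral_mono' measurableSet_Ioo hbd
    _ = _ := by simp

theorem exists_basis [FiniteDimensional ℝ V] (P : InnerProd V) :
    ∃ e : Module.Basis (Fin (Module.finrank ℝ V)) ℝ V,
      ∀ v i, |e.repr v i| ≤ Real.sqrt (P.form v v) := by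
  let core := P.toCore
  let _ : NormedAddCommGroup V := core.toNormedAddCommGroup
  let _ : InnerProductSpace ℝ V := .ofCore core.toCore
  refine ⟨(stdOrthonormalBasis ℝ V).toBasis, fun v i => ?_⟩
  have h1 : P.form v v = ‖v‖ ^ 2 := real_inner_self_eq_norm_sq v
  rw [h1, Real.sqrt_sq (norm_nonneg v), OrthonormalBasis.coe_toBasis_repr_apply,
    OrthonormalBasis.repr_apply_apply]
  refine (abs_real_inner_le_norm _ _).trans ?_
  rw [(stdOrthonormalBasis ℝ V).norm_eq_one, one_mul]

/-- The distance topology is not finer than that of entrywise convergence. -/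
theorem tendsto_of_tendsto_form [FiniteDimensional ℝ V] {α : Type*} {l : Filter α}
    {P : α → InnerProd V} {Q : InnerProd V}
    (h : ∀ v w, Tendsto (fun a => (P a).form v w) l (𝓝 (Q.form v w))) :
    Tendsto (fun a => edist (P a) Q) l (𝓝 0) := by
  set n := Module.finrank ℝ V with hn
  obtain ⟨e, he⟩ : ∃ e : Module.Basis (Fin n) ℝ V,
    ∀ v i, |e.repr v i| ≤ Real.sqrt (Q.form v v) := Q.exists_basis
  rw [ENNReal.tendsto_nhds_zero]
  intro ε hε
  obtain ⟨δ, hδ0, hδ⟩ : ∃ δ : ℝ, 0 < δ ∧ ENNReal.ofReal δ ≤ ε := by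
    rcases eq_or_ne ε ∞ with rfl | hε'
    · exact ⟨1, one_pos, le_top⟩
    · exact ⟨ε.toReal, ENNReal.toReal_pos hε.ne' hε', by rw [ENNReal.ofReal_toReal hε']⟩
  obtain ⟨K, hK0, hK2, hKδ⟩ : ∃ K : ℝ, 0 < K ∧ K ≤ 1 / 2 ∧ Real.sqrt (n * (2 * K) ^ 2) ≤ δ := by
    have hc : Tendsto (fun K : ℝ => Real.sqrt (n * (2 * K) ^ 2)) (𝓝[>] 0) (𝓝 0) := by
      have : Continuous (fun K : ℝ => Real.sqrt (n * (2 * K) ^ 2)) := by fun_prop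
      have h0 := this.tendsto 0
      simp only [mul_zero, ne_eq, OfNat.ofNat_ne_zero, not_false_eq_true, zero_pow,
        Real.sqrt_zero] at h0
      exact h0.mono_left nhdsWithin_le_nhds
    have h1 := hc.eventually (ge_mem_nhds hδ0)
    have h2 : ∀ᶠ K : ℝ in 𝓝[>] 0, K ≤ 1 / 2 :=
      nhdsWithin_le_nhds (ge_mem_nhds (by norm_num))
    obtain ⟨K, ⟨h3, h4⟩, h5⟩ := ((h1.and h2).and self_mem_nhdsWithin).exists
    exact ⟨K, h5, h4, h3⟩
  have hη : 0 < K / ((n : ℝ) ^ 2 + 1) := by positivity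
  have hev : ∀ᶠ a in l, ∀ i j, |(P a).form (e i) (e j) - Q.form (e i) (e j)| ≤
      K / ((n : ℝ) ^ 2 + 1) := by
    refine eventually_all.2 fun i => eventually_all.2 fun j => ?_
    have := (h (e i) (e j)).sub_const (Q.form (e i) (e j))
    rw [sub_self] at this
    have h2 := this.abs
    rw [abs_zero] at h2
    exact h2.eventually (ge_mem_nhds hη)
  filter_upwards [hev] with a ha
  rw [edist_comm]
  refine (edist_le_of_close Q (P a) hK0.le hK2 fun v w => ?_).trans
    ((ENNReal.ofReal_le_ofReal hKδ).trans hδ)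
  set D : LinearMap.BilinForm ℝ V := (P a).form - Q.form
  have hD : (P a).form v w - Q.form v w = D v w := by simp [D]
  have hexp : D v w = ∑ i, ∑ j, e.repr v i * (e.repr w j * D (e i) (e j)) := by
    conv_lhs => rw [← e.sum_repr v, ← e.sum_repr w]
    simp only [map_sum, LinearMap.sum_apply, map_smul, LinearMap.smul_apply, smul_eq_mul]
    simp only [Finset.mul_sum]
    rw [Finset.sum_comm]
    exact Finset.sum_congr rfl fun i _ => Finset.sum_congr rfl fun j _ => by ring
  rw [hD, hexp]
  have hsv := Real.sqrt_nonneg (Q.form v v)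
  have hsw := Real.sqrt_nonneg (Q.form w w)
  calc |∑ i, ∑ j, e.repr v i * (e.repr w j * D (e i) (e j))|
      ≤ ∑ i, ∑ j, |e.repr v i * (e.repr w j * D (e i) (e j))| :=
        (Finset.abs_sum_le_sum_abs _ _).trans
          (Finset.sum_le_sum fun i _ => Finset.abs_sum_le_sum_abs _ _)
    _ ≤ ∑ _i : Fin n, ∑ _j : Fin n, Real.sqrt (Q.form v v) * (Real.sqrt (Q.form w w) *
          (K / ((n : ℝ) ^ 2 + 1))) := by
        refine Finset.sum_le_sum fun i _ => Finset.sum_le_sum fun j _ => ?_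
        rw [abs_mul, abs_mul]
        have h3 : |D (e i) (e j)| ≤ K / ((n : ℝ) ^ 2 + 1) := by simpa [D] using ha i j
        gcongr
        · exact he v i
        · exact he w j
    _ = ((n : ℝ) ^ 2 / ((n : ℝ) ^ 2 + 1)) *
          (K * Real.sqrt (Q.form v v) * Real.sqrt (Q.form w w)) := by
        simp only [Finset.sum_const, Finset.card_univ, Fintype.card_fin, nsmul_eq_mul]
        ring
    _ ≤ 1 * (K * Real.sqrt (Q.form v v) * Real.sqrt (Q.form w w)) := by
        gcongr
        rw [div_le_one (by positivity)]
        linarith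
    _ = _ := one_mul _

end InnerProd

/-! ### Continuous fields of metric spaces, continuum products and variation of measures -/

/-- The data of a continuous field of (Hilbert-Hadamard) metric spaces over `Z`: the fibers with
their metrics, and the set of continuous sections. -/
structure MetricField (Z : Type*) where
  Fiber : Z → Type*
  [edistFiber : ∀ z, EDist (Fiber z)]
  contSections : Set (∀ z, Fiber z)

attribute [instance] MetricField.edistFiber

namespace MetricField

variable {Z : Type*} (C : MetricField Z)

/-- The pointwise distance of two sections. -/
def secDist (s t : ∀ z, C.Fiber z) : Z → ℝ≥0∞ := fun z => edist (s z) (t z)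

/-- A set of sections is mutually co-measurable if all pointwise distances are measurable. -/
def MutuallyCoMeasurable [MeasurableSpace Z] (S : Set (∀ z, C.Fiber z)) : Prop :=
  ∀ s ∈ S, ∀ t ∈ S, Measurable (C.secDist s t)

/-- The measurable sections of the associated measurable field. -/
def measSections [MeasurableSpace Z] : Set (∀ z, C.Fiber z) :=
  {s | C.MutuallyCoMeasurable (insert s C.contSections)}

/-- Measurable sections at finite `L²`-distance from a continuous section. -/
def IsL2 [MeasurableSpace Z] (μ : Measure Z) (s : ∀ z, C.Fiber z) : Prop :=
  s ∈ C.measSections ∧ ∃ s₀ ∈ C.contSections, ∫⁻ z, C.secDist s s₀ z ^ 2 ∂μ < ⊤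

/-- Almost everywhere equality of square integrable sections. -/
def l2Setoid [MeasurableSpace Z] (μ : Measure Z) : Setoid {s // C.IsL2 μ s} where
  r s t := ∀ᵐ z ∂μ, s.1 z = t.1 z
  iseqv :=
    { refl := fun s => Eventually.of_forall fun _ => rfl
      symm := fun h => h.mono fun _ hz => hz.symm
      trans := fun h h' => by filter_upwards [h, h'] with z hz hz' using hz.trans hz' }

/-- The `L²`-continuum product `L²(Z, μ, C)`. -/
def L2 [MeasurableSpace Z] (μ : Measure Z) : Type _ := Quotient (C.l2Setoid μ)

/-- The class of a square integrable section. -/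
def toL2 [MeasurableSpace Z] {μ : Measure Z} (s : ∀ z, C.Fiber z) (hs : C.IsL2 μ s) : C.L2 μ :=
  Quotient.mk (C.l2Setoid μ) ⟨s, hs⟩

/-- The `L²`-distance `(∫ d(s, t)² dμ)^(1/2)`. -/
noncomputable instance [MeasurableSpace Z] (μ : Measure Z) : EDist (C.L2 μ) where
  edist x y := Quotient.liftOn₂ x y
    (fun s t => (∫⁻ z, C.secDist s.1 t.1 z ^ 2 ∂μ) ^ (1 / 2 : ℝ))
    (fun s t s' t' hs ht => by
      have hs : ∀ᵐ z ∂μ, s.1 z = s'.1 z := hs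
      have ht : ∀ᵐ z ∂μ, t.1 z = t'.1 z := ht
      refine congrArg (· ^ (1 / 2 : ℝ)) (lintegral_congr_ae ?_)
      filter_upwards [hs, ht] with z h1 h2
      simp only [secDist, h1, h2])

theorem edist_toL2 [MeasurableSpace Z] {μ : Measure Z} (s t : ∀ z, C.Fiber z) (hs : C.IsL2 μ s)
    (ht : C.IsL2 μ t) :
    edist (C.toL2 s hs) (C.toL2 t ht) = (∫⁻ z, C.secDist s t z ^ 2 ∂μ) ^ (1 / 2 : ℝ) := rfl

variable [TopologicalSpace Z] [MeasurableSpace Z] [OpensMeasurableSpace Z]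

/-- The diagonal image of the continuous sections of `C` in `∏_{ν ∈ Y} L²(Z, ν, C)`. -/
def diagonal (Y : Set (ProbabilityMeasure Z)) :
    Set (∀ ν : Y, C.L2 (ν.1 : Measure Z)) :=
  {S | ∃ s ∈ C.contSections, ∀ ν, ∃ hs : C.IsL2 (ν.1 : Measure Z) s, S ν = C.toL2 s hs}

/-- The continuous field `C|_Y` of `L²`-continuum products over a set `Y` of probability measures
(with the topology of weak convergence): the fiber at `ν` is `L²(Z, ν, C)`, and the continuous
sections are generated by the diagonal image of the continuous sections of `C`: they are the sections
`S` that are co-continuous with the diagonal ones, that is, all distances are continuous in `ν`. -/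
noncomputable def overProb (Y : Set (ProbabilityMeasure Z)) : MetricField Y where
  Fiber ν := C.L2 (ν.1 : Measure Z)
  contSections := {S | ∀ a ∈ insert S (C.diagonal Y), ∀ b ∈ insert S (C.diagonal Y),
    Continuous fun ν => edist (a ν) (b ν)}

end MetricField

/-- An isometric left action of a group `G` on a field: `base g` is the induced right action on the
base space and `fiberMap g z : C_{base g z} → C_z` are isometries, which carry continuous sections
to continuous sections. -/
structure IsometricAction (G : Type*) [Group G] {Z : Type*} [TopologicalSpace Z]
    (C : MetricField Z) where
  base : G → Z → Z
  fiberMap : ∀ g z, C.Fiber (base g z) → C.Fiber z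
  continuous_base : ∀ g, Continuous (base g)
  isometry : ∀ g z x y, edist (fiberMap g z x) (fiberMap g z y) = edist x y
  map_contSections : ∀ g, ∀ s ∈ C.contSections,
    (fun z => fiberMap g z (s (base g z))) ∈ C.contSections
  base_one : ∀ z, base 1 z = z
  base_mul : ∀ g h z, base (g * h) z = base h (base g z)
  fiberMap_one : ∀ (s : ∀ z, C.Fiber z) z, fiberMap 1 z (s (base 1 z)) = s z
  fiberMap_mul : ∀ g h (s : ∀ z, C.Fiber z) z, fiberMap (g * h) z (s (base (g * h) z)) =
    fiberMap g z (fiberMap h (base g z) (s (base h (base g z))))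

namespace IsometricAction

variable {G : Type*} [Group G] {Z : Type*} [TopologicalSpace Z] {C : MetricField Z}

/-- The action on sections. -/
def act (α : IsometricAction G C) (g : G) (s : ∀ z, C.Fiber z) : ∀ z, C.Fiber z :=
  fun z => α.fiberMap g z (s (α.base g z))

theorem act_one (α : IsometricAction G C) (s : ∀ z, C.Fiber z) : α.act 1 s = s :=
  funext (α.fiberMap_one s)

theorem act_mul (α : IsometricAction G C) (g h : G) (s : ∀ z, C.Fiber z) :
    α.act (g * h) s = α.act g (α.act h s) :=
  funext (α.fiberMap_mul g h s)

theorem secDist_act (α : IsometricAction G C) (g : G) (s t : ∀ z, C.Fiber z) :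
    C.secDist (α.act g s) (α.act g t) = C.secDist s t ∘ α.base g :=
  funext fun z => α.isometry g z _ _

/-- The restriction of an action to a subgroup. -/
def restrict (α : IsometricAction G C) (H : Subgroup G) : IsometricAction H C where
  base g := α.base g
  fiberMap g := α.fiberMap g
  continuous_base g := α.continuous_base g
  isometry g := α.isometry g
  map_contSections g := α.map_contSections g
  base_one := α.base_one
  base_mul g h := α.base_mul g h
  fiberMap_one := α.fiberMap_one
  fiberMap_mul g h := α.fiberMap_mul g h

/-- Metric properness: for every continuous section `s`, the infimum over the base space of the
distance from `s` to `γ s` tends to infinity as `γ → ∞` in the group. -/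
def MetricallyProper (α : IsometricAction G C) : Prop :=
  ∀ s ∈ C.contSections, ∀ R : ℝ≥0, {γ : G | ⨅ z, edist (s z) (α.act γ s z) < R}.Finite

theorem act_mem_insert (α : IsometricAction G C) (g : G) {s t : ∀ z, C.Fiber z}
    (ht : t ∈ insert (α.act g s) C.contSections) :
    ∃ t' ∈ insert s C.contSections, t = α.act g t' := by
  rcases ht with rfl | ht
  · exact ⟨s, mem_insert _ _, rfl⟩
  · refine ⟨α.act g⁻¹ t, mem_insert_of_mem _ (α.map_contSections _ _ ht), ?_⟩
    rw [← α.act_mul, mul_inv_cancel, α.act_one]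

theorem base_inv_base (α : IsometricAction G C) (g : G) (z : Z) :
    α.base g⁻¹ (α.base g z) = z := by
  rw [← α.base_mul, mul_inv_cancel, α.base_one]

/-- The base maps are homeomorphisms. -/
def baseHomeo (α : IsometricAction G C) (g : G) : Z ≃ₜ Z where
  toFun := α.base g
  invFun := α.base g⁻¹
  left_inv := α.base_inv_base g
  right_inv z := by simpa using α.base_inv_base g⁻¹ z
  continuous_toFun := α.continuous_base g
  continuous_invFun := α.continuous_base g⁻¹

section Induced

variable [MeasurableSpace Z] [BorelSpace Z]

theorem measurable_base (α : IsometricAction G C) (g : G) : Measurable (α.base g) :=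
  (α.continuous_base g).measurable

/-- The induced right action on probability measures, `ν ↦ (base g)_* ν`. -/
noncomputable def push (α : IsometricAction G C) (g : G) (ν : ProbabilityMeasure Z) :
    ProbabilityMeasure Z :=
  ν.map (α.measurable_base g).aemeasurable

theorem coe_push (α : IsometricAction G C) (g : G) (ν : ProbabilityMeasure Z) :
    (α.push g ν : Measure Z) = (ν : Measure Z).map (α.base g) := rfl

theorem act_isL2 (α : IsometricAction G C) (g : G) {ν : Measure Z} {s : ∀ z, C.Fiber z}
    (hs : C.IsL2 (ν.map (α.base g)) s) : C.IsL2 ν (α.act g s) := by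
  obtain ⟨hm, s₀, hs₀, hfin⟩ := hs
  refine ⟨fun a ha b hb => ?_, α.act g s₀, α.map_contSections g s₀ hs₀, ?_⟩
  · obtain ⟨a', ha', rfl⟩ := α.act_mem_insert g ha
    obtain ⟨b', hb', rfl⟩ := α.act_mem_insert g hb
    rw [α.secDist_act]
    exact (hm a' ha' b' hb').comp (α.measurable_base g)
  · rw [α.secDist_act]
    rwa [lintegral_map ((hm s (mem_insert _ _) s₀ (mem_insert_of_mem _ hs₀)).pow_const 2)
      (α.measurable_base g)] at hfin

/-- The map `(α_g)_* : L²(Z, (base g)_* ν, C) → L²(Z, ν, C)`. -/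
noncomputable def l2Map (α : IsometricAction G C) (g : G) (ν : Measure Z) :
    C.L2 (ν.map (α.base g)) → C.L2 ν :=
  Quotient.map' (s₁ := C.l2Setoid _) (s₂ := C.l2Setoid _)
    (fun s => ⟨α.act g s.1, α.act_isL2 g s.2⟩) (fun s t hst => by
      have hst : ∀ᵐ z ∂ν.map (α.base g), s.1 z = t.1 z := hst
      have h := ae_of_ae_map (α.measurable_base g).aemeasurable hst
      change ∀ᵐ z ∂ν, α.act g s.1 z = α.act g t.1 z
      filter_upwards [h] with z hz
      simp only [act, hz])

theorem l2Map_toL2 (α : IsometricAction G C) (g : G) (ν : Measure Z) (s : ∀ z, C.Fiber z)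
    (hs : C.IsL2 (ν.map (α.base g)) s) :
    α.l2Map g ν (C.toL2 s hs) = C.toL2 (α.act g s) (α.act_isL2 g hs) := rfl

theorem edist_l2Map (α : IsometricAction G C) (g : G) (ν : Measure Z)
    (x y : C.L2 (ν.map (α.base g))) :
    edist (α.l2Map g ν x) (α.l2Map g ν y) = edist x y := by
  induction x using Quotient.inductionOn with | _ s
  induction y using Quotient.inductionOn with | _ t
  change edist (C.toL2 (α.act g s.1) _) (C.toL2 (α.act g t.1) _) = edist (C.toL2 s.1 s.2)
    (C.toL2 t.1 t.2)
  rw [C.edist_toL2, C.edist_toL2, α.secDist_act]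
  have h := (α.baseHomeo g).measurableEmbedding.lintegral_map (μ := ν)
    (fun z => C.secDist s.1 t.1 z ^ 2)
  exact congrArg (fun r : ℝ≥0∞ => r ^ (1 / 2 : ℝ)) h.symm

set_option linter.unusedSectionVars false in
theorem l2_congr {Y : Set (ProbabilityMeasure Z)} {X : Sort*} {y₁ y₂ : Y} (h : y₁ = y₂)
    (S : ∀ ν : Y, C.L2 (ν.1 : Measure Z)) (F₁ : C.L2 (y₁.1 : Measure Z) → X)
    (F₂ : C.L2 (y₂.1 : Measure Z) → X)
    (hF : ∀ s h₁ h₂, F₁ (C.toL2 s h₁) = F₂ (C.toL2 s h₂)) : F₁ (S y₁) = F₂ (S y₂) := by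
  subst h
  induction S y₁ using Quotient.inductionOn with | _ s
  exact hF s.1 s.2 s.2

/-- The action on `C|_Y` induced by an action on `C`, for an invariant set `Y` of probability
measures. -/
noncomputable def overProb (α : IsometricAction G C) (Y : Set (ProbabilityMeasure Z))
    (hY : ∀ g, ∀ ν ∈ Y, α.push g ν ∈ Y) : IsometricAction G (C.overProb Y) where
  base g ν := ⟨α.push g ν.1, hY g ν.1 ν.2⟩
  fiberMap g ν := α.l2Map g (ν.1 : Measure Z)
  continuous_base g := by
    refine Continuous.subtype_mk ?_ _
    exact (ProbabilityMeasure.continuous_map (α.continuous_base g)).comp continuous_subtype_val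
  isometry g ν x y := α.edist_l2Map g _ x y
  map_contSections g S hS := by
    have hβ : Continuous fun ν : Y => (⟨α.push g ν.1, hY g ν.1 ν.2⟩ : Y) := by
      refine Continuous.subtype_mk ?_ _
      exact (ProbabilityMeasure.continuous_map (α.continuous_base g)).comp continuous_subtype_val
    have key : ∀ a ∈ insert (fun ν : Y => α.l2Map g (ν.1 : Measure Z)
          (S ⟨α.push g ν.1, hY g ν.1 ν.2⟩)) (C.diagonal Y), ∃ a' ∈ insert S (C.diagonal Y),
        ∀ ν : Y, a ν = α.l2Map g (ν.1 : Measure Z) (a' ⟨α.push g ν.1, hY g ν.1 ν.2⟩) := by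
      rintro a (rfl | ⟨s, hs, ha⟩)
      · exact ⟨S, mem_insert _ _, fun ν => rfl⟩
      · have hs' := α.map_contSections g⁻¹ s hs
        have hL : ∀ ν : Y, C.IsL2 (ν.1 : Measure Z) (α.act g⁻¹ s) := by
          intro ν
          obtain ⟨h, -⟩ := ha ⟨α.push g⁻¹ ν.1, hY g⁻¹ ν.1 ν.2⟩
          exact α.act_isL2 g⁻¹ h
        refine ⟨fun ν => C.toL2 (α.act g⁻¹ s) (hL ν), mem_insert_of_mem _
          ⟨_, hs', fun ν => ⟨hL ν, rfl⟩⟩, fun ν => ?_⟩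
        obtain ⟨h, h'⟩ := ha ν
        rw [h']
        change _ = C.toL2 (α.act g (α.act g⁻¹ s)) _
        congr 1
        rw [← α.act_mul, mul_inv_cancel, α.act_one]
    intro a ha b hb
    obtain ⟨a', ha', haa⟩ := key a ha
    obtain ⟨b', hb', hbb⟩ := key b hb
    refine ((hS a' ha' b' hb').comp hβ).congr fun ν => ?_
    rw [haa, hbb]
    exact (α.edist_l2Map g _ _ _).symm
  base_one ν := by
    refine Subtype.ext (Subtype.ext ?_)
    change (ν.1 : Measure Z).map (α.base 1) = _
    rw [show α.base 1 = id from funext α.base_one, Measure.map_id]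
    rfl
  base_mul g h ν := by
    refine Subtype.ext (Subtype.ext ?_)
    change (ν.1 : Measure Z).map (α.base (g * h)) =
      ((ν.1 : Measure Z).map (α.base g)).map (α.base h)
    rw [Measure.map_map (α.measurable_base h) (α.measurable_base g)]
    exact congrArg (fun f => (ν.1 : Measure Z).map f) (funext (α.base_mul g h))
  fiberMap_one S ν := by
    refine l2_congr (C := C) (y₁ := ⟨α.push 1 ν.1, hY 1 ν.1 ν.2⟩) (y₂ := ν) ?_ S
      (α.l2Map 1 (ν.1 : Measure Z)) id ?_
    · refine Subtype.ext (Subtype.ext ?_)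
      change (ν.1 : Measure Z).map (α.base 1) = _
      rw [show α.base 1 = id from funext α.base_one, Measure.map_id]
      rfl
    · intro s h₁ h₂
      change C.toL2 (α.act 1 s) _ = C.toL2 s h₂
      congr 1
      exact α.act_one s
  fiberMap_mul g h S ν := by
    refine l2_congr (C := C) (y₁ := ⟨α.push (g * h) ν.1, hY (g * h) ν.1 ν.2⟩)
      (y₂ := ⟨α.push h (α.push g ν.1), hY h _ (hY g ν.1 ν.2)⟩) ?_ S
      (α.l2Map (g * h) (ν.1 : Measure Z))
      (fun x => α.l2Map g (ν.1 : Measure Z)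
        (α.l2Map h ((ν.1 : Measure Z).map (α.base g)) x)) ?_
    · refine Subtype.ext (Subtype.ext ?_)
      change (ν.1 : Measure Z).map (α.base (g * h)) =
        ((ν.1 : Measure Z).map (α.base g)).map (α.base h)
      rw [Measure.map_map (α.measurable_base h) (α.measurable_base g)]
      exact congrArg (fun f => (ν.1 : Measure Z).map f) (funext (α.base_mul g h))
    · intro s h₁ h₂
      change C.toL2 (α.act (g * h) s) _ = C.toL2 (α.act g (α.act h s)) _
      congr 1
      exact α.act_mul g h s

end Induced

end IsometricAction

/-! ### The field of inner products on the tangent spaces of a closed manifold -/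

section Manifold

variable {n : ℕ} {N : Type*} [TopologicalSpace N] [ChartedSpace (EuclideanSpace ℝ (Fin n)) N]

instance instFiniteDimensionalTangentSpace (z : N) :
    FiniteDimensional ℝ (TangentSpace (𝓡 n) z) :=
  inferInstanceAs (FiniteDimensional ℝ (EuclideanSpace ℝ (Fin n)))

/-- The diffeomorphisms of `N`. -/
abbrev Diff (n : ℕ) (N : Type*) [TopologicalSpace N]
    [ChartedSpace (EuclideanSpace ℝ (Fin n)) N] : Type _ :=
  N ≃ₘ^(((⊤ : ℕ∞) : ℕ∞ω))⟮𝓡 n, 𝓡 n⟯ N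

/-- The diffeomorphism group, with `φ * ψ = φ ∘ ψ`. -/
noncomputable instance instGroupDiff : Group (Diff n N) where
  mul φ ψ := ψ.trans φ
  one := Diffeomorph.refl _ _ _
  inv φ := φ.symm
  mul_assoc _ _ _ := Diffeomorph.ext fun _ => rfl
  one_mul _ := Diffeomorph.ext fun _ => rfl
  mul_one _ := Diffeomorph.ext fun _ => rfl
  inv_mul_cancel φ := Diffeomorph.ext fun x => φ.symm_apply_apply x

theorem diff_mul_apply (φ ψ : Diff n N) (x : N) : (φ * ψ) x = φ (ψ x) := rfl

theorem diff_one_apply (x : N) : (1 : Diff n N) x = x := rfl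

theorem diff_inv_eq (φ : Diff n N) : φ⁻¹ = φ.symm := rfl

/-- The derivative of a diffeomorphism. -/
noncomputable def diffD (φ : Diff n N) (z : N) :
    TangentSpace (𝓡 n) z ≃ₗ[ℝ] TangentSpace (𝓡 n) (φ z) :=
  (φ.mfderivToContinuousLinearEquiv (by simp) z).toLinearEquiv

theorem diffD_apply (φ : Diff n N) (z : N) (v : TangentSpace (𝓡 n) z) :
    diffD φ z v = mfderiv (𝓡 n) (𝓡 n) φ z v := rfl

variable [IsManifold (𝓡 n) (((⊤ : ℕ∞) : ℕ∞ω)) N]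

/-- Continuous fields of inner products on the tangent spaces: the squared length of tangent vectors
is a continuous function on the tangent bundle. -/
def IsContinuousMetric (s : ∀ z : N, InnerProd (TangentSpace (𝓡 n) z)) : Prop :=
  Continuous fun p : TangentBundle (𝓡 n) N => (s p.1).form p.2 p.2

variable (n N) in
/-- The continuous field `Riem(N)` over `N`, with fiber `𝒫(T_z N)` at `z`. -/
noncomputable def riem : MetricField N where
  Fiber z := InnerProd (TangentSpace (𝓡 n) z)
  contSections := {s | IsContinuousMetric s}

theorem polarization {V : Type*} [AddCommGroup V] [Module ℝ V] (P : InnerProd V) (v w : V) :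
    P.form v w = (P.form (v + w) (v + w) - P.form v v - P.form w w) / 2 := by
  simp only [map_add, LinearMap.add_apply, P.symm w v]
  ring

/-- The chart-wise description: in a local trivialization of the tangent bundle, the coefficients of
a continuous metric are continuous. -/
theorem IsContinuousMetric.continuousAt_trivialization
    {s : ∀ z : N, InnerProd (TangentSpace (𝓡 n) z)} (hs : IsContinuousMetric s) (x : N)
    (v w : EuclideanSpace ℝ (Fin n)) :
    let e := trivializationAt (EuclideanSpace ℝ (Fin n)) (TangentSpace (𝓡 n) : N → Type _) x
    ContinuousAt (fun b => (s b).form (e.symmₗ ℝ b v) (e.symmₗ ℝ b w)) x := by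
  intro e
  have hx : x ∈ e.baseSet := FiberBundle.mem_baseSet_trivializationAt' x
  have key : ∀ v : EuclideanSpace ℝ (Fin n),
      ContinuousAt (fun b => (s b).form (e.symmₗ ℝ b v) (e.symmₗ ℝ b v)) x := by
    intro v
    have h1 : ContinuousAt (fun b => e.toOpenPartialHomeomorph.symm (b, v)) x :=
      e.continuousOn_symm_prodMk_left.continuousAt (e.open_baseSet.mem_nhds hx)
    have h2 := (Continuous.continuousAt hs).comp h1
    refine h2.congr ?_
    filter_upwards [e.open_baseSet.mem_nhds hx] with b hb
    have h3 : (⟨b, e.symm b v⟩ : TangentBundle (𝓡 n) N) = e.toOpenPartialHomeomorph.symm (b, v) :=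
      e.mk_symm hb v
    simp only [Function.comp]
    rw [← h3]
    simp only [e.symmₗ_apply hb]
    rfl
  have := (((key (v + w)).sub (key v)).sub (key w)).div_const 2
  refine this.congr (Eventually.of_forall fun b => ?_)
  have h := polarization (s b) (e.symmₗ ℝ b v) (e.symmₗ ℝ b w)
  rw [← map_add] at h
  exact h.symm

theorem IsContinuousMetric.continuous_edist
    {s t : ∀ z : N, InnerProd (TangentSpace (𝓡 n) z)} (hs : IsContinuousMetric s)
    (ht : IsContinuousMetric t) : Continuous fun z => edist (s z) (t z) := by
  classical
  rw [continuous_iff_continuousAt]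
  intro x
  set e := trivializationAt (EuclideanSpace ℝ (Fin n)) (TangentSpace (𝓡 n) : N → Type _) x with he
  have hx : x ∈ e.baseSet := FiberBundle.mem_baseSet_trivializationAt' x
  let T : ∀ b, b ∈ e.baseSet → (EuclideanSpace ℝ (Fin n) ≃ₗ[ℝ] TangentSpace (𝓡 n) b) :=
    fun b hb => (e.linearEquivAt ℝ b hb).symm
  let loc : (∀ z : N, InnerProd (TangentSpace (𝓡 n) z)) → N →
      InnerProd (EuclideanSpace ℝ (Fin n)) := fun r b =>
    if hb : b ∈ e.baseSet then InnerProd.pullback (T b hb) (r b)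
    else InnerProd.pullback (T x hx) (r x)
  have hloc : ∀ r, IsContinuousMetric r → Tendsto (loc r) (𝓝 x) (𝓝 (loc r x)) := by
    intro r hr
    rw [tendsto_iff_edist_tendsto_0]
    refine InnerProd.tendsto_of_tendsto_form fun v w => ?_
    have hform : ∀ b, b ∈ e.baseSet →
        (loc r b).form v w = (r b).form (e.symmₗ ℝ b v) (e.symmₗ ℝ b w) := by
      intro b hb
      simp only [loc, dif_pos hb, InnerProd.pullback_apply, T, e.linearEquivAt_symm_apply,
        e.symmₗ_apply hb]
    rw [hform x hx]
    refine (hr.continuousAt_trivialization x v w).tendsto.congr' ?_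
    filter_upwards [e.open_baseSet.mem_nhds hx] with b hb
    exact (hform b hb).symm
  have hval : ∀ b, b ∈ e.baseSet → edist (loc s b) (loc t b) = edist (s b) (t b) := by
    intro b hb
    simp only [loc, dif_pos hb]
    exact InnerProd.edist_pullback _ _ _
  have h := (hloc s hs).edist (hloc t ht)
  rw [hval x hx] at h
  refine h.congr' ?_
  filter_upwards [e.open_baseSet.mem_nhds hx] with b hb
  exact hval b hb

/-- The pushforward of metrics is an isometric action of the diffeomorphism group on `Riem(N)`: the
map on the base is `φ⁻¹`, and `𝒫(T_{φ⁻¹ z} N) → 𝒫(T_z N)` is the pullback along `D_z φ⁻¹`. -/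
noncomputable def diffAction : IsometricAction (Diff n N) (riem n N) where
  base φ z := φ⁻¹ z
  fiberMap φ z P := InnerProd.pullback (diffD φ⁻¹ z) P
  continuous_base φ := φ⁻¹.continuous
  isometry φ z P Q := InnerProd.edist_pullback _ P Q
  map_contSections φ s hs := by
    have h1 : Continuous (tangentMap (𝓡 n) (𝓡 n) (φ⁻¹ : Diff n N)) :=
      φ⁻¹.contMDiff.continuous_tangentMap (by simp)
    exact (Continuous.comp hs h1).congr fun p => rfl
  base_one z := rfl
  base_mul φ ψ z := rfl
  fiberMap_one s z := by
    refine InnerProd.ext' fun v w => ?_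
    have h : ∀ v, diffD (1⁻¹ : Diff n N) z v = v := fun v =>
      congrArg (fun L => L v) (mfderiv_id (I := 𝓡 n) (x := z))
    exact (InnerProd.pullback_apply _ _ _ _).trans (by rw [h v, h w]; rfl)
  fiberMap_mul φ ψ s z := by
    refine InnerProd.ext' fun v w => ?_
    have h : ∀ v, diffD (φ * ψ)⁻¹ z v = diffD ψ⁻¹ (φ⁻¹ z) (diffD φ⁻¹ z v) := fun v =>
      mfderiv_comp_apply (I := 𝓡 n) (I' := 𝓡 n) (I'' := 𝓡 n) z
        (ψ⁻¹.mdifferentiable (by simp) _) (φ⁻¹.mdifferentiable (by simp) z) v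
    refine (InnerProd.pullback_apply _ _ _ _).trans ?_
    rw [h v, h w]
    rfl

/-- Smooth Riemannian metrics on `N`. -/
abbrev SmoothMetric (n : ℕ) (N : Type*) [TopologicalSpace N]
    [ChartedSpace (EuclideanSpace ℝ (Fin n)) N] [IsManifold (𝓡 n) (((⊤ : ℕ∞) : ℕ∞ω)) N] : Type _ :=
  Bundle.ContMDiffRiemannianMetric (𝓡 n) (((⊤ : ℕ∞) : ℕ∞ω)) (EuclideanSpace ℝ (Fin n))
    (TangentSpace (𝓡 n) : N → Type _)

/-- The section of `Riem(N)` given by a Riemannian metric. -/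
noncomputable def metricSection (g : SmoothMetric n N) (z : N) :
    InnerProd (TangentSpace (𝓡 n) z) where
  form := LinearMap.mk₂ ℝ (fun v w => g.inner z v w) (fun v v' w => by simp) (fun c v w => by simp)
    (fun v w w' => by simp) (fun c v w => by simp)
  symm := g.symm z
  pos := g.pos z

theorem metricSection_form (g : SmoothMetric n N) (z : N) (v w : TangentSpace (𝓡 n) z) :
    (metricSection g z).form v w = g.inner z v w := rfl

theorem metricSection_mem (g : SmoothMetric n N) :
    metricSection g ∈ (riem n N).contSections := by
  have hid : Continuous fun p : TangentBundle (𝓡 n) N =>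
      Bundle.TotalSpace.mk' (EuclideanSpace ℝ (Fin n)) p.1 p.2 := continuous_id
  have h0 : Continuous fun p : TangentBundle (𝓡 n) N => p.1 :=
    FiberBundle.continuous_proj _ _
  have h : Continuous fun p : TangentBundle (𝓡 n) N =>
      Bundle.TotalSpace.mk' ℝ (E := Bundle.Trivial N ℝ) p.1 (g.inner p.1 p.2 p.2) :=
    Continuous.clm_bundle_apply₂ (F₁ := EuclideanSpace ℝ (Fin n))
      (F₂ := EuclideanSpace ℝ (Fin n)) (g.contMDiff.continuous.comp h0) hid hid
  have h' := (Bundle.Trivial.homeomorphProd N ℝ).continuous.comp h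
  exact continuous_snd.comp h'

end Manifold

/-! ### The conditions on a group of diffeomorphisms -/

section Discrete

/-- The operator norm of a linear map between the Euclidean spaces `(V, P)` and `(W, Q)`. -/
noncomputable def opNorm {V W : Type*} [AddCommGroup V] [Module ℝ V] [AddCommGroup W] [Module ℝ W]
    (P : InnerProd V) (Q : InnerProd W) (T : V →ₗ[ℝ] W) : ℝ :=
  sSup {r | ∃ v, P.form v v ≤ 1 ∧ r = Real.sqrt (Q.form (T v) (T v))}

variable {n : ℕ} {N : Type*} [TopologicalSpace N] [ChartedSpace (EuclideanSpace ℝ (Fin n)) N]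
  [IsManifold (𝓡 n) (((⊤ : ℕ∞) : ℕ∞ω)) N] [MeasurableSpace N] [BorelSpace N]

/-- The norm `‖D_x φ‖_g`. -/
noncomputable def diffNorm (g : SmoothMetric n N) (φ : Diff n N) (x : N) : ℝ :=
  opNorm (metricSection g x) (metricSection g (φ x)) (diffD φ x).toLinearMap

/-- The pseudometric `d_{μ,g}(φ, ψ)`, the square root of
`∫ (log max {‖D_{φ⁻¹ x} (ψ⁻¹ φ)‖_g, ‖D_{ψ⁻¹ x} (φ⁻¹ ψ)‖_g})² dμ(x)`. -/
noncomputable def diffDist (μ : ProbabilityMeasure N) (g : SmoothMetric n N) (φ ψ : Diff n N) :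
    ℝ≥0∞ :=
  (∫⁻ x, ENNReal.ofReal (Real.log (max (diffNorm g (ψ⁻¹ * φ) (φ⁻¹ x))
    (diffNorm g (φ⁻¹ * ψ) (ψ⁻¹ x))) ^ 2) ∂(μ : Measure N)) ^ (1 / 2 : ℝ)

/-- The pushforward `φ_* μ`. -/
noncomputable def pushMeasure (φ : Diff n N) (μ : ProbabilityMeasure N) : ProbabilityMeasure N :=
  μ.map φ.continuous.measurable.aemeasurable

/-- `Γ` is `μ`-discrete: `inf_{τ ∈ Γ} d_{τ_* μ, g}(γ, 1) → ∞` as `γ → ∞` in `Γ`. -/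
def MuDiscrete (Γ : Subgroup (Diff n N)) (μ : ProbabilityMeasure N) (g : SmoothMetric n N) : Prop :=
  ∀ R : ℝ≥0, {γ : Γ | ⨅ τ : Γ, diffDist (pushMeasure (τ : Diff n N) μ) g γ 1 < R}.Finite

/-- The orbit `Γ · μ`. -/
def orbit (Γ : Subgroup (Diff n N)) (μ : ProbabilityMeasure N) : Set (ProbabilityMeasure N) :=
  {ν | ∃ γ ∈ Γ, ν = pushMeasure γ μ}

/-- The closed convex hull of the orbit `Γ · μ` in `Prob(N)`. -/
def orbitHull (Γ : Subgroup (Diff n N)) (μ : ProbabilityMeasure N) : Set (ProbabilityMeasure N) :=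
  closure {ν | (ν : Measure N) ∈
    convexHull ℝ≥0 ((fun ν : ProbabilityMeasure N => (ν : Measure N)) '' orbit Γ μ)}

theorem push_eq (Γ : Subgroup (Diff n N)) (γ : Γ) (ν : ProbabilityMeasure N) :
    (diffAction.restrict Γ).push γ ν = pushMeasure (γ : Diff n N)⁻¹ ν := rfl

set_option linter.unusedSectionVars false in
theorem pushMeasure_mul (φ ψ : Diff n N) (ν : ProbabilityMeasure N) :
    pushMeasure (φ * ψ) ν = pushMeasure φ (pushMeasure ψ ν) := by
  refine Subtype.ext ?_
  exact (Measure.map_map φ.continuous.measurable ψ.continuous.measurable).symm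

set_option linter.unusedSectionVars false in
theorem continuous_pushMeasure (φ : Diff n N) : Continuous (pushMeasure φ) :=
  ProbabilityMeasure.continuous_map φ.continuous

theorem pushMeasure_mem_orbit (Γ : Subgroup (Diff n N)) (μ : ProbabilityMeasure N) (γ : Γ)
    {ν : ProbabilityMeasure N} (hν : ν ∈ orbit Γ μ) :
    pushMeasure (γ : Diff n N)⁻¹ ν ∈ orbit Γ μ := by
  obtain ⟨δ, hδ, rfl⟩ := hν
  exact ⟨(γ : Diff n N)⁻¹ * δ, Γ.mul_mem (Γ.inv_mem γ.2) hδ, (pushMeasure_mul _ _ _).symm⟩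

/-- The orbit closure is invariant. -/
theorem orbitClosure_invariant (Γ : Subgroup (Diff n N)) (μ : ProbabilityMeasure N) (γ : Γ) :
    ∀ ν ∈ closure (orbit Γ μ), (diffAction.restrict Γ).push γ ν ∈ closure (orbit Γ μ) := by
  intro ν hν
  rw [push_eq]
  exact map_mem_closure (continuous_pushMeasure _) hν
    fun ν' hν' => pushMeasure_mem_orbit Γ μ γ hν'

/-- The closed convex hull of the orbit is invariant. -/
theorem orbitHull_invariant (Γ : Subgroup (Diff n N)) (μ : ProbabilityMeasure N) (γ : Γ) :
    ∀ ν ∈ orbitHull Γ μ, (diffAction.restrict Γ).push γ ν ∈ orbitHull Γ μ := by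
  intro ν hν
  rw [push_eq]
  refine map_mem_closure (continuous_pushMeasure _) hν fun ν' hν' => ?_
  set H := convexHull ℝ≥0 ((fun ν : ProbabilityMeasure N => (ν : Measure N)) '' orbit Γ μ)
  have hf : Measurable ((γ : Diff n N)⁻¹ : Diff n N) :=
    ((γ : Diff n N)⁻¹ : Diff n N).continuous.measurable
  have hsub : H ⊆ {m : Measure N | m.map ((γ : Diff n N)⁻¹ : Diff n N) ∈ H} := by
    refine convexHull_min ?_ ?_
    · rintro _ ⟨ν₀, hν₀, rfl⟩
      exact subset_convexHull _ _ ⟨_, pushMeasure_mem_orbit Γ μ γ hν₀, rfl⟩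
    · intro m₁ h₁ m₂ h₂ a b ha hb hab
      change Measure.map _ (a • m₁ + b • m₂) ∈ H
      rw [Measure.map_add _ _ hf, Measure.map_smul, Measure.map_smul]
      exact convex_convexHull _ _ h₁ h₂ ha hb hab
  exact hsub hν'

/-- The action of `Γ` on `Riem(N)|_Y`, where `Y` is the closure of `Γ · μ`. -/
noncomputable def orbitClosureAction (Γ : Subgroup (Diff n N)) (μ : ProbabilityMeasure N) :
    IsometricAction Γ ((riem n N).overProb (closure (orbit Γ μ))) :=
  (diffAction.restrict Γ).overProb (closure (orbit Γ μ)) (orbitClosure_invariant Γ μ)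

/-- The action of `Γ` on `Riem(N)|_Y`, where `Y` is the closed convex hull of `Γ · μ`. -/
noncomputable def orbitHullAction (Γ : Subgroup (Diff n N)) (μ : ProbabilityMeasure N) :
    IsometricAction Γ ((riem n N).overProb (orbitHull Γ μ)) :=
  (diffAction.restrict Γ).overProb (orbitHull Γ μ) (orbitHull_invariant Γ μ)

/-- Continuous sections of `Riem(N)` are square integrable. -/
theorem isL2_of_mem_contSections {s : ∀ z, (riem n N).Fiber z}
    (hs : s ∈ (riem n N).contSections) (ν : Measure N) : (riem n N).IsL2 ν s := by
  refine ⟨fun a ha b hb => ?_, s, hs, ?_⟩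
  · rw [Set.insert_eq_of_mem hs] at ha hb
    exact (IsContinuousMetric.continuous_edist ha hb).measurable
  · have h : ∀ z, (riem n N).secDist s s z = 0 := fun z => InnerProd.edist_self' (s z)
    simp [h]

/-- The point `γ(g)` of `L²(N, μ, Riem(N))`. -/
noncomputable def translate (μ : ProbabilityMeasure N) (g : SmoothMetric n N) (γ : Diff n N) :
    (riem n N).L2 (μ : Measure N) :=
  (riem n N).toL2 (diffAction.act γ (metricSection g))
    (isL2_of_mem_contSections (diffAction.map_contSections γ _ (metricSection_mem g)) _)

end Discrete

/-- Coarse embeddings of metric spaces. -/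
def IsCoarseEmbedding {X Y : Type*} [PseudoMetricSpace X] [EDist Y] (f : X → Y) : Prop :=
  ∃ ρ₁ ρ₂ : ℝ≥0 → ℝ≥0, Monotone ρ₁ ∧ Monotone ρ₂ ∧ Tendsto ρ₁ atTop atTop ∧
    ∀ x x', (ρ₁ (nndist x x') : ℝ≥0∞) ≤ edist (f x) (f x') ∧
      edist (f x) (f x') ≤ (ρ₂ (nndist x x') : ℝ≥0∞)

/-- A metric on a (discrete) group is left-invariant and proper, i.e. has finite balls. -/
def IsProperLeftInvariant {G : Type*} [Group G] (m : MetricSpace G) : Prop :=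
  (∀ g x y : G, m.dist (g * x) (g * y) = m.dist x y) ∧ ∀ r : ℝ, {x : G | m.dist 1 x ≤ r}.Finite

/-- A map from a discrete group is a coarse embedding if the group has a proper left-invariant
metric (that is, the group is countable) and the map is a coarse embedding with respect to every
such metric (any two of which are coarsely equivalent). -/
def IsGroupCoarseEmbedding {G Y : Type*} [Group G] [EDist Y] (f : G → Y) : Prop :=
  (∃ m : MetricSpace G, IsProperLeftInvariant m) ∧
    ∀ m : MetricSpace G, IsProperLeftInvariant m →
      IsCoarseEmbedding (X := G) (Y := Y) f

end RiemField

/-!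
All four conditions say that the displacement of the metric `g` tends to infinity along `Γ`: for each
`R`, only finitely many `γ` satisfy `d(g, γ g) < R` in `L²(N, ν, Riem(N))` for some `ν` in the orbit
of `μ` (`MovesMetric`).

For the discreteness condition this is a comparison in each tangent space. If `M` is the logarithm of
the larger of the operator norms of the identity maps between `(V, P)` and `(V, Q)`, then
`2 M ≤ d(P, Q) ≤ 2 √n M`. The lower bound holds because the logarithmic derivative of `c(v, v)` along
a path `c` of inner products is at most the speed of `c` (`Path.log_sub_log_le_length`); the upper
bound is the length of the path `diag (l i ^ t)` in a basis that diagonalizes both inner products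
(`edist_le_of_form_le`). Integration over `N` gives `muDiscrete_iff`.

For the induced actions (`metricallyProper_overProb_iff`), the diagonal section `g` is one of the
continuous sections. Conversely, any continuous section is at bounded distance from it, since
`Prob(N)` is compact and the distance is finite and continuous; as the action is isometric, the
triangle inequality compares their displacements. It remains to compare the sets of measures. The
function `ν ↦ ∫ d(g, γ g)² dν` is continuous and affine, so a lower bound on the orbit is a lower
bound on its closed convex hull (`MovesMetric.orbitHull`).

For the orbit map (`isGroupCoarseEmbedding_iff`), `d(τ g, τ γ g)` in `L²(μ)` equals `d(g, γ g)` in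
`L²(τ⁻¹ μ)`, which gives the lower control function. The upper one comes from the uniform distance
`sup_z d(g_z, (γ g)_z)`, which is finite by compactness of `N` and invariant under `Γ`. The same
uniform distance, with the discrete metric added, is a proper left-invariant metric on `Γ`.
-/

namespace RiemField

/-! ### The distance on the space of inner products -/
namespace InnerProd

variable {V : Type*} [AddCommGroup V] [Module ℝ V]

/-- Two inner products are simultaneously diagonalizable: in the coordinates of some basis, `P` is
the standard inner product and `Q` is diagonal with positive entries. -/
theorem exists_simultaneous_diagonalization [FiniteDimensional ℝ V] (P Q : InnerProd V) :
    ∃ (e : Module.Basis (Fin (Module.finrank ℝ V)) ℝ V) (l : Fin (Module.finrank ℝ V) → ℝ),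
      (∀ i, 0 < l i) ∧ (∀ v w, P.form v w = ∑ i, e.repr v i * e.repr w i) ∧
        ∀ v w, Q.form v w = ∑ i, l i * (e.repr v i * e.repr w i) := by
  let core := P.toCore
  let _ : NormedAddCommGroup V := core.toNormedAddCommGroup
  let _ : InnerProductSpace ℝ V := .ofCore core.toCore
  have hin : ∀ v w : V, inner ℝ v w = P.form v w := fun _ _ => rfl
  set L := Q.form.symmCompOfNondegenerate P.form P.nondegenerate with hL
  have hL1 : ∀ v w, P.form (L v) w = Q.form v w := symmComp_apply P Q.form
  have hsymm : L.IsSymmetric := fun v w => by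
    rw [hin, hin, hL1, P.symm v (L w), hL1, Q.symm]
  let e := hsymm.eigenvectorBasis rfl
  let l := hsymm.eigenvalues rfl
  have hQ : ∀ i w, Q.form (e i) w = l i * P.form (e i) w := fun i w => by
    rw [← hL1, show L (e i) = l i • e i from hsymm.apply_eigenvectorBasis rfl i]
    simp
  have hP1 : ∀ i, P.form (e i) (e i) = 1 := fun i => by
    rw [← hin, real_inner_self_eq_norm_sq, e.norm_eq_one, one_pow]
  have hrepr : ∀ v i, e.toBasis.repr v i = P.form (e i) v := fun v i => by
    rw [OrthonormalBasis.coe_toBasis_repr_apply, OrthonormalBasis.repr_apply_apply, hin]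
  refine ⟨e.toBasis, l, fun i => ?_, fun v w => ?_, fun v w => ?_⟩
  · have h1 := Q.pos (e i) (by simpa using e.toBasis.ne_zero i)
    rwa [hQ, hP1, mul_one] at h1
  · rw [← hin, ← e.sum_inner_mul_inner v w]
    refine Finset.sum_congr rfl fun i _ => ?_
    rw [hrepr, hrepr, hin, hin, P.symm v]
  · conv_lhs => rw [← e.toBasis.sum_repr v]
    simp only [map_sum, LinearMap.sum_apply, map_smul, LinearMap.smul_apply, smul_eq_mul]
    refine Finset.sum_congr rfl fun i _ => ?_
    rw [OrthonormalBasis.coe_toBasis, hQ, ← hrepr w i]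
    ring

/-- A two-sided bound for `Q` in terms of `P` bounds their distance: if `Q = diag (l i)` in an
orthonormal basis of `P`, the path `t ↦ diag (l i ^ t)` has constant speed `(∑ (log (l i))²)^(1/2)`. -/
theorem edist_le_of_form_le [FiniteDimensional ℝ V] (P Q : InnerProd V) {K : ℝ} (hK : 0 ≤ K)
    (hPQ : ∀ v, P.form v v ≤ Real.exp K * Q.form v v)
    (hQP : ∀ v, Q.form v v ≤ Real.exp K * P.form v v) :
    edist P Q ≤ ENNReal.ofReal (Real.sqrt (Module.finrank ℝ V) * K) := by
  obtain ⟨e, l, hl, hP, hQ⟩ := exists_simultaneous_diagonalization P Q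
  have hPe : ∀ i, P.form (e i) (e i) = 1 := fun i => by
    simp [hP, Finsupp.single_apply]
  have hQe : ∀ i, Q.form (e i) (e i) = l i := fun i => by
    simp [hQ, Finsupp.single_apply]
  have hlog : ∀ i, |Real.log (l i)| ≤ K := fun i => by
    have h1 := hPQ (e i)
    have h2 := hQP (e i)
    rw [hPe, hQe] at h1 h2
    rw [abs_le]
    constructor
    · rw [Real.le_log_iff_exp_le (hl i), Real.exp_neg, inv_le_iff_one_le_mul₀ (Real.exp_pos K)]
      linarith
    · rw [Real.log_le_iff_le_exp (hl i)]
      linarith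
  -- the diagonal form with entries `m i` in the basis `e`
  let D : (Fin (Module.finrank ℝ V) → ℝ) → LinearMap.BilinForm ℝ V := fun m =>
    ∑ i, m i • (LinearMap.mul ℝ ℝ).compl₁₂ (e.coord i) (e.coord i)
  have hD : ∀ m v w, D m v w = ∑ i, m i * (e.repr v i * e.repr w i) := fun m v w => by
    simp [D, LinearMap.sum_apply]
  let E : ℝ → InnerProd V := fun t =>
    { form := D fun i => Real.exp (t * Real.log (l i))
      symm := fun v w => by
        simp only [hD]
        exact Finset.sum_congr rfl fun i _ => by ring
      pos := fun v hv => by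
        rw [hD]
        refine Finset.sum_pos' (fun i _ => mul_nonneg (Real.exp_pos _).le (mul_self_nonneg _)) ?_
        obtain ⟨i, hi⟩ : ∃ i, e.repr v i ≠ 0 := by
          by_contra! h
          exact hv (e.repr.map_eq_zero_iff.1 (Finsupp.ext h))
        exact ⟨i, Finset.mem_univ _, mul_pos (Real.exp_pos _) (mul_self_pos.2 hi)⟩ }
  have hE : ∀ t v w, (E t).form v w =
      ∑ i, Real.exp (t * Real.log (l i)) * (e.repr v i * e.repr w i) := fun t v w => hD _ v w
  let c : Path P Q :=
    { toFun := E
      velocity := fun t => D fun i => Real.log (l i) * Real.exp (t * Real.log (l i))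
      breaks := ∅
      source := ext' fun v w => by simp [hE, hP]
      target := ext' fun v w => by simp [hE, hQ, Real.exp_log (hl _)]
      contDiffOn := fun a b _ _ _ _ v w => by
        simp only [hE]
        fun_prop
      hasDerivAt := fun t _ _ v w => by
        simp only [hE, hD]
        refine HasDerivAt.fun_sum fun i _ => HasDerivAt.mul_const ?_ _
        have := ((hasDerivAt_id t).mul_const (Real.log (l i))).exp
        simpa [mul_comm] using this }
  refine (iInf_le _ c).trans ?_
  have hbd : ∀ t, Real.sqrt (normSq (c.toFun t) (c.velocity t)) ≤
      Real.sqrt (Module.finrank ℝ V) * K := by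
    intro t
    have hsq : Real.sqrt (Module.finrank ℝ V * K ^ 2) = Real.sqrt (Module.finrank ℝ V) * K := by
      rw [Real.sqrt_mul (Nat.cast_nonneg _), Real.sqrt_sq hK]
    rw [← hsq]
    refine Real.sqrt_le_sqrt (normSq_le _ _ (fun v w => ?_) hK fun v w => ?_)
    · simp only [c, hD]
      exact Finset.sum_congr rfl fun i _ => by ring
    · simp only [c, hD, hE]
      set m := fun i => Real.exp (t * Real.log (l i))
      have hm : ∀ i, 0 ≤ m i := fun i => (Real.exp_pos _).le
      have hsplit : ∀ i, |Real.log (l i) * m i * (e.repr v i * e.repr w i)| ≤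
          K * ((Real.sqrt (m i) * |e.repr v i|) * (Real.sqrt (m i) * |e.repr w i|)) := fun i => by
        rw [abs_mul, abs_mul, abs_mul, abs_of_nonneg (hm i)]
        calc _ ≤ K * m i * (|e.repr v i| * |e.repr w i|) := by
              gcongr
              exact hlog i
          _ = _ := by
              conv_lhs => rw [← Real.mul_self_sqrt (hm i)]
              ring
      have hnorm : ∀ u, ∑ i, (Real.sqrt (m i) * |e.repr u i|) ^ 2 =
          ∑ i, m i * (e.repr u i * e.repr u i) := fun u =>
        Finset.sum_congr rfl fun i _ => by
          rw [mul_pow, Real.sq_sqrt (hm i), sq_abs, sq]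
      calc |∑ i, Real.log (l i) * m i * (e.repr v i * e.repr w i)|
          ≤ ∑ i, |Real.log (l i) * m i * (e.repr v i * e.repr w i)| :=
            Finset.abs_sum_le_sum_abs _ _
        _ ≤ ∑ i, K * ((Real.sqrt (m i) * |e.repr v i|) * (Real.sqrt (m i) * |e.repr w i|)) :=
            Finset.sum_le_sum fun i _ => hsplit i
        _ = K * ∑ i, (Real.sqrt (m i) * |e.repr v i|) * (Real.sqrt (m i) * |e.repr w i|) := by
            rw [Finset.mul_sum]
        _ ≤ K * (Real.sqrt (∑ i, (Real.sqrt (m i) * |e.repr v i|) ^ 2) *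
              Real.sqrt (∑ i, (Real.sqrt (m i) * |e.repr w i|) ^ 2)) := by
            gcongr
            exact Real.sum_mul_le_sqrt_mul_sqrt _ _ _
        _ = _ := by rw [hnorm, hnorm, mul_assoc]
  calc c.length ≤ ∫⁻ _t in Ioo (0 : ℝ) 1,
        ENNReal.ofReal (Real.sqrt (Module.finrank ℝ V) * K) :=
        lintegral_mono fun t => ENNReal.ofReal_le_ofReal (hbd t)
    _ = _ := by simp

/-- The distance between two inner products is finite: they are comparable. -/
theorem edist_ne_top [FiniteDimensional ℝ V] (P Q : InnerProd V) : edist P Q ≠ ⊤ := by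
  obtain ⟨e, l, hl, hP, hQ⟩ := exists_simultaneous_diagonalization P Q
  set K := ∑ i, |Real.log (l i)|
  have hlog : ∀ i, |Real.log (l i)| ≤ K := fun i =>
    Finset.single_le_sum (f := fun i => |Real.log (l i)|) (fun j _ => abs_nonneg _)
      (Finset.mem_univ i)
  refine ((edist_le_of_form_le P Q (K := K) (Finset.sum_nonneg fun j _ => abs_nonneg _)
    (fun v => ?_) fun v => ?_).trans_lt ENNReal.ofReal_lt_top).ne
  · rw [hP, hQ, Finset.mul_sum]
    refine Finset.sum_le_sum fun i _ => ?_
    rw [← mul_assoc]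
    refine le_mul_of_one_le_left (mul_self_nonneg _) ?_
    have h1 : Real.exp (-K) ≤ l i :=
      (Real.le_log_iff_exp_le (hl i)).1 (abs_le.1 (hlog i)).1
    have h2 : Real.exp K * Real.exp (-K) = 1 := by rw [← Real.exp_add]; simp
    rw [← h2]
    gcongr
  · rw [hP, hQ, Finset.mul_sum]
    refine Finset.sum_le_sum fun i _ => mul_le_mul_of_nonneg_right ?_ (mul_self_nonneg _)
    exact (Real.log_le_iff_le_exp (hl i)).1 (abs_le.1 (hlog i)).2

/-- The operator norm of the symmetric endomorphism `P⁻¹ A` is at most its Hilbert-Schmidt norm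
`Tr (P⁻¹ A P⁻¹ A) ^ (1/2)`. -/
theorem abs_apply_self_le [FiniteDimensional ℝ V] (P : InnerProd V) (A : LinearMap.BilinForm ℝ V)
    (hA : ∀ v w, A v w = A w v) (v : V) :
    |A v v| ≤ Real.sqrt (normSq P A) * P.form v v := by
  let core := P.toCore
  let _ : NormedAddCommGroup V := core.toNormedAddCommGroup
  let _ : InnerProductSpace ℝ V := .ofCore core.toCore
  have hin : ∀ v w : V, inner ℝ v w = P.form v w := fun _ _ => rfl
  set L := A.symmCompOfNondegenerate P.form P.nondegenerate with hL
  have hL1 : ∀ v w, P.form (L v) w = A v w := symmComp_apply P A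
  set e := stdOrthonormalBasis ℝ V
  have hn : normSq P A = ∑ i, ‖L (e i)‖ ^ 2 := by
    unfold normSq
    rw [← hL, LinearMap.trace_eq_sum_inner _ e]
    refine Finset.sum_congr rfl fun i _ => ?_
    rw [← real_inner_self_eq_norm_sq, hin, hin, P.symm, LinearMap.comp_apply, hL1, hA, hL1]
  have hLv : ‖L v‖ ≤ Real.sqrt (normSq P A) * ‖v‖ := by
    calc ‖L v‖ = ‖∑ i, e.repr v i • L (e i)‖ := by
          conv_lhs => rw [← e.sum_repr v]
          simp only [map_sum, map_smul]
      _ ≤ ∑ i, ‖L (e i)‖ * ‖e.repr v i‖ := by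
          refine (norm_sum_le _ _).trans (Finset.sum_le_sum fun i _ => ?_)
          rw [norm_smul, mul_comm]
      _ ≤ Real.sqrt (∑ i, ‖L (e i)‖ ^ 2) * Real.sqrt (∑ i, ‖e.repr v i‖ ^ 2) :=
          Real.sum_mul_le_sqrt_mul_sqrt _ _ _
      _ = _ := by
          rw [hn, ← EuclideanSpace.norm_eq, e.repr.norm_map]
  rw [← hL1, ← hin, ← hin, real_inner_self_eq_norm_sq]
  calc |inner ℝ (L v) v| ≤ ‖L v‖ * ‖v‖ := abs_real_inner_le_norm _ _
    _ ≤ Real.sqrt (normSq P A) * ‖v‖ * ‖v‖ := by gcongr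
    _ = _ := by ring

/-- The entries of a path are continuous, also at the break points. -/
theorem Path.continuousOn {P Q : InnerProd V} (c : Path P Q) (v w : V) :
    ContinuousOn (fun t => (c.toFun t).form v w) (Icc 0 1) := by
  intro t ht
  set f := fun t => (c.toFun t).form v w
  have hfin : (c.breaks : Set ℝ).Finite := c.breaks.finite_toSet
  -- near `t`, the only possible break point is `t` itself
  have hU : ((c.breaks : Set ℝ) \ {t})ᶜ ∈ 𝓝 t :=
    (hfin.subset sdiff_subset).isClosed.isOpen_compl.mem_nhds (by simp)
  obtain ⟨ε, hε, hball⟩ := Metric.mem_nhds_iff.1 hU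
  have hb : ∀ s, |s - t| < ε → s ≠ t → s ∉ (c.breaks : Set ℝ) := fun s hs hst h =>
    hball (by simpa [Real.dist_eq] using hs) ⟨h, hst⟩
  have hleft : ContinuousWithinAt f (Icc 0 1 ∩ Iic t) t := by
    rcases ht.1.eq_or_lt with h0 | h0
    · refine (continuousWithinAt_singleton (f := f) (x := t)).mono ?_
      rintro s ⟨hs, hst⟩
      exact le_antisymm hst (h0 ▸ hs.1)
    · have h1 := c.contDiffOn (max 0 (t - ε)) t (le_max_left _ _) (max_lt h0 (by linarith)) ht.2
        (Set.disjoint_left.2 fun s hs => hb s (by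
          have := (le_max_right 0 (t - ε)).trans_lt hs.1
          rw [abs_lt]; constructor <;> linarith [hs.2]) hs.2.ne) v w
      refine (h1.continuousOn t ⟨(max_lt h0 (by linarith)).le, le_rfl⟩).mono_of_mem_nhdsWithin ?_
      have h2 : Ioi (max 0 (t - ε)) ∈ 𝓝 t := Ioi_mem_nhds (max_lt h0 (by linarith))
      filter_upwards [mem_nhdsWithin_of_mem_nhds h2, self_mem_nhdsWithin] with s hs hs'
      exact ⟨le_of_lt hs, hs'.2⟩
  have hright : ContinuousWithinAt f (Icc 0 1 ∩ Ici t) t := by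
    rcases ht.2.eq_or_lt with h0 | h0
    · refine (continuousWithinAt_singleton (f := f) (x := t)).mono ?_
      rintro s ⟨hs, hst⟩
      exact le_antisymm (h0 ▸ hs.2) hst
    · have h1 := c.contDiffOn t (min 1 (t + ε)) ht.1 (lt_min h0 (by linarith)) (min_le_left _ _)
        (Set.disjoint_left.2 fun s hs => hb s (by
          have := hs.2.trans_le (min_le_right 1 (t + ε))
          rw [abs_lt]; constructor <;> linarith [hs.1]) hs.1.ne') v w
      refine (h1.continuousOn t ⟨le_rfl, (lt_min h0 (by linarith)).le⟩).mono_of_mem_nhdsWithin ?_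
      have h2 : Iio (min 1 (t + ε)) ∈ 𝓝 t := Iio_mem_nhds (lt_min h0 (by linarith))
      filter_upwards [mem_nhdsWithin_of_mem_nhds h2, self_mem_nhdsWithin] with s hs hs'
      exact ⟨hs'.2, le_of_lt hs⟩
  refine (hleft.union hright).mono fun s hs => ?_
  rcases le_total s t with h | h
  · exact Or.inl ⟨hs, h⟩
  · exact Or.inr ⟨hs, h⟩

/-- Along a path `c`, the function `log c(v, v)` is Lipschitz with respect to arc length. -/
theorem Path.log_sub_log_le_length [FiniteDimensional ℝ V] {P Q : InnerProd V} (c : Path P Q)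
    {v : V} (hv : v ≠ 0) :
    ENNReal.ofReal (Real.log (Q.form v v) - Real.log (P.form v v)) ≤ c.length := by
  set f := fun t => Real.log ((c.toFun t).form v v) with hf
  have hpos : ∀ t, 0 < (c.toFun t).form v v := fun t => (c.toFun t).pos v hv
  have hder : ∀ t ∈ Ioo (0 : ℝ) 1 \ (c.breaks : Set ℝ),
      HasDerivAt f (c.velocity t v v / (c.toFun t).form v v) t := fun t ht =>
    (c.hasDerivAt t ht.1 ht.2 v v).log (hpos t).ne'
  have hspeed : ∀ t ∈ Ioo (0 : ℝ) 1 \ (c.breaks : Set ℝ),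
      ‖deriv f t‖ₑ ≤ ENNReal.ofReal (Real.sqrt (normSq (c.toFun t) (c.velocity t))) := by
    intro t ht
    have hsym : ∀ v w, c.velocity t v w = c.velocity t w v := fun v w =>
      (c.hasDerivAt t ht.1 ht.2 v w).unique
        ((c.hasDerivAt t ht.1 ht.2 w v).congr_of_eventuallyEq
          (Eventually.of_forall fun s => (c.toFun s).symm v w))
    rw [(hder t ht).deriv, ← ofReal_norm, Real.norm_eq_abs, abs_div,
      abs_of_pos (hpos t)]
    refine ENNReal.ofReal_le_ofReal ?_
    rw [div_le_iff₀ (hpos t)]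
    exact abs_apply_self_le _ _ hsym v
  have hlen : ∫⁻ t in Ioo (0 : ℝ) 1, ‖deriv f t‖ₑ ≤ c.length := by
    refine lintegral_mono_ae ?_
    have h0 : ∀ᵐ t : ℝ, t ∉ (c.breaks : Set ℝ) :=
      c.breaks.finite_toSet.countable.ae_notMem volume
    filter_upwards [ae_restrict_of_ae h0, ae_restrict_mem measurableSet_Ioo] with t h1 h2
    exact hspeed t ⟨h2, h1⟩
  rcases eq_or_ne c.length ⊤ with htop | htop
  · rw [htop]; exact le_top
  -- `deriv f` is measurable for any `f`, so the bound on its integral makes it integrable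
  have hint : IntervalIntegrable (deriv f) volume 0 1 := by
    rw [intervalIntegrable_iff_integrableOn_Ioo_of_le zero_le_one]
    exact ⟨(measurable_deriv f).aestronglyMeasurable, hlen.trans_lt htop.lt_top⟩
  have hFTC : ∫ t in (0 : ℝ)..1, deriv f t = f 1 - f 0 :=
    integral_eq_of_hasDerivAt_off_countable_of_le f (deriv f) zero_le_one
      c.breaks.finite_toSet.countable
      ((c.continuousOn v v).log fun t _ => (hpos t).ne')
      (fun t ht => (hder t ht).differentiableAt.hasDerivAt) hint
  have hends : Real.log (Q.form v v) - Real.log (P.form v v) = f 1 - f 0 := by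
    simp only [hf, c.source, c.target]
  rw [hends, ← hFTC, intervalIntegral.integral_of_le zero_le_one,
    integral_Ioc_eq_integral_Ioo]
  refine le_trans ?_ hlen
  refine (ENNReal.ofReal_le_ofReal (le_abs_self _)).trans ?_
  rw [← Real.norm_eq_abs, ofReal_norm]
  exact enorm_integral_le_lintegral_enorm _

/-- The converse to `edist_le_of_form_le`: the distance controls the ratio of the two forms. -/
theorem form_le_exp_edist_mul [FiniteDimensional ℝ V] (P Q : InnerProd V) (v : V) :
    Q.form v v ≤ Real.exp (edist P Q).toReal * P.form v v := by
  rcases eq_or_ne v 0 with rfl | hv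
  · simp
  have h1 : ENNReal.ofReal (Real.log (Q.form v v) - Real.log (P.form v v)) ≤ edist P Q :=
    le_iInf fun c => c.log_sub_log_le_length hv
  rw [ENNReal.ofReal_le_iff_le_toReal (edist_ne_top P Q)] at h1
  rw [← Real.log_le_log_iff (Q.pos v hv) (mul_pos (Real.exp_pos _) (P.pos v hv)),
    Real.log_mul (Real.exp_pos _).ne' (P.pos v hv).ne', Real.log_exp]
  linarith

end InnerProd

/-! ### Operator norms and the distance of inner products -/

section OperatorNorm

open InnerProd

variable {V W : Type*} [AddCommGroup V] [Module ℝ V] [AddCommGroup W] [Module ℝ W]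

theorem opNorm_eq_opNorm_pullback (P : InnerProd V) (Q : InnerProd W) (T : V ≃ₗ[ℝ] W) :
    opNorm P Q T.toLinearMap = opNorm P (pullback T Q) LinearMap.id := by
  simp [opNorm]

theorem opNorm_symm_eq_opNorm_pullback (P : InnerProd V) (Q : InnerProd W) (T : V ≃ₗ[ℝ] W) :
    opNorm Q P T.symm.toLinearMap = opNorm (pullback T Q) P LinearMap.id := by
  unfold opNorm
  congr 1
  ext r
  constructor
  · rintro ⟨w, hw, rfl⟩
    exact ⟨T.symm w, by simpa using hw, by simp⟩
  · rintro ⟨v, hv, rfl⟩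
    exact ⟨T v, by simpa using hv, by simp⟩

theorem opNorm_id_le (P Q : InnerProd V) {c : ℝ} (hc : 0 ≤ c)
    (h : ∀ v, Q.form v v ≤ c ^ 2 * P.form v v) : opNorm P Q LinearMap.id ≤ c := by
  refine csSup_le ⟨_, 0, by simp, rfl⟩ ?_
  rintro _ ⟨v, hv, rfl⟩
  refine Real.sqrt_le_iff.2 ⟨hc, (h v).trans ?_⟩
  exact mul_le_of_le_one_right (sq_nonneg c) hv

theorem opNorm_id_nonneg (P Q : InnerProd V) : 0 ≤ opNorm P Q LinearMap.id :=
  Real.sSup_nonneg (by rintro _ ⟨v, -, rfl⟩; exact Real.sqrt_nonneg _)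

theorem form_le_opNorm_id_sq_mul [FiniteDimensional ℝ V] (P Q : InnerProd V) (v : V) :
    Q.form v v ≤ opNorm P Q LinearMap.id ^ 2 * P.form v v := by
  rcases eq_or_ne v 0 with rfl | hv
  · simp
  have hbdd : BddAbove {r | ∃ v, P.form v v ≤ 1 ∧
      r = Real.sqrt (Q.form ((LinearMap.id : V →ₗ[ℝ] V) v) ((LinearMap.id : V →ₗ[ℝ] V) v))} := by
    refine ⟨Real.sqrt (Real.exp (edist P Q).toReal), ?_⟩
    rintro _ ⟨v, hv, rfl⟩
    refine Real.sqrt_le_sqrt ((form_le_exp_edist_mul P Q v).trans ?_)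
    exact mul_le_of_le_one_right (Real.exp_pos _).le hv
  have hp := P.pos v hv
  have hs := Real.sqrt_pos.2 hp
  have hunit : P.form ((Real.sqrt (P.form v v))⁻¹ • v) ((Real.sqrt (P.form v v))⁻¹ • v) ≤ 1 := by
    simp only [map_smul, LinearMap.smul_apply, smul_eq_mul]
    rw [← mul_assoc, ← mul_inv, Real.mul_self_sqrt hp.le, inv_mul_cancel₀ hp.ne']
  have h1 : Real.sqrt (Q.form v v) / Real.sqrt (P.form v v) ≤ opNorm P Q LinearMap.id := by
    refine le_csSup hbdd ⟨_, hunit, ?_⟩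
    simp only [LinearMap.id_apply, map_smul, LinearMap.smul_apply, smul_eq_mul]
    rw [← mul_assoc, ← mul_inv, Real.mul_self_sqrt hp.le, ← Real.sqrt_div (Q.nonneg v),
      div_eq_inv_mul]
  rw [div_le_iff₀ hs] at h1
  calc Q.form v v = Real.sqrt (Q.form v v) ^ 2 := (Real.sq_sqrt (Q.nonneg v)).symm
    _ ≤ (opNorm P Q LinearMap.id * Real.sqrt (P.form v v)) ^ 2 := by gcongr
    _ = _ := by rw [mul_pow, Real.sq_sqrt hp.le]

/-- The logarithm of the larger of the two operator norms of the identity map between `(V, P)` and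
`(V, Q)`. In the zero space it is `log 0 = 0`. -/
noncomputable def logDistortion (P Q : InnerProd V) : ℝ :=
  Real.log (max (opNorm P Q LinearMap.id) (opNorm Q P LinearMap.id))

theorem logDistortion_comm (P Q : InnerProd V) : logDistortion P Q = logDistortion Q P := by
  rw [logDistortion, logDistortion, max_comm]

theorem form_le_exp_logDistortion_mul [FiniteDimensional ℝ V] (P Q : InnerProd V) (v : V) :
    Q.form v v ≤ Real.exp (2 * logDistortion P Q) * P.form v v := by
  rcases eq_or_ne v 0 with rfl | hv
  · simp
  have h1 := form_le_opNorm_id_sq_mul P Q v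
  have hpos : 0 < opNorm P Q LinearMap.id := by
    refine (opNorm_id_nonneg P Q).lt_of_ne fun h => ?_
    rw [← h] at h1
    linarith [Q.pos v hv]
  have hmax := hpos.trans_le (le_max_left _ (opNorm Q P LinearMap.id))
  refine h1.trans (mul_le_mul_of_nonneg_right ?_ (P.nonneg v))
  rw [two_mul, Real.exp_add, logDistortion, Real.exp_log hmax, ← sq]
  gcongr
  exact le_max_left _ _

theorem logDistortion_nonneg [FiniteDimensional ℝ V] (P Q : InnerProd V) :
    0 ≤ logDistortion P Q := by
  by_cases htriv : ∀ v : V, v = 0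
  · have h0 : ∀ P Q : InnerProd V, opNorm P Q LinearMap.id = 0 := fun P Q =>
      le_antisymm (opNorm_id_le P Q le_rfl fun v => by rw [htriv v]; simp) (opNorm_id_nonneg P Q)
    simp [logDistortion, h0]
  push Not at htriv
  obtain ⟨v, hv⟩ := htriv
  by_contra! hneg
  have h1 := form_le_exp_logDistortion_mul P Q v
  have h2 := form_le_exp_logDistortion_mul Q P v
  rw [logDistortion_comm Q P] at h2
  have h3 : Real.exp (2 * logDistortion P Q) < 1 := by
    rw [← Real.exp_zero]
    exact Real.exp_lt_exp.2 (by linarith)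
  have := P.pos v hv
  have := Q.pos v hv
  nlinarith

/-- The lower estimate of the distance by operator norms: `d(P, Q) = D` makes both operator norms at
most `exp (D / 2)`, since they are square roots of ratios of `P` and `Q`. -/
theorem two_mul_logDistortion_le [FiniteDimensional ℝ V] (P Q : InnerProd V) :
    2 * logDistortion P Q ≤ (edist P Q).toReal := by
  set D := (edist P Q).toReal
  have hD : 0 ≤ D := ENNReal.toReal_nonneg
  have hsq : Real.exp (D / 2) ^ 2 = Real.exp D := by
    rw [← Real.exp_nat_mul]; congr 1; push_cast; ring
  have hmax : max (opNorm P Q LinearMap.id) (opNorm Q P LinearMap.id) ≤ Real.exp (D / 2) := by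
    refine max_le (opNorm_id_le P Q (Real.exp_pos _).le fun v => ?_)
      (opNorm_id_le Q P (Real.exp_pos _).le fun v => ?_)
    · rw [hsq]
      exact form_le_exp_edist_mul P Q v
    · rw [hsq]
      simpa only [D, edist_comm P Q] using form_le_exp_edist_mul Q P v
  rcases (le_max_of_le_left (opNorm_id_nonneg P Q) :
    0 ≤ max (opNorm P Q LinearMap.id) (opNorm Q P LinearMap.id)).eq_or_lt with h0 | h0
  · rw [logDistortion, ← h0, Real.log_zero]
    linarith
  · have := (Real.log_le_iff_le_exp h0).2 hmax
    rw [logDistortion]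
    linarith

/-- The upper estimate of the distance by operator norms; together with
`two_mul_logDistortion_le`, it compares the two quantities up to a factor depending on `dim V`
only. -/
theorem edist_le_ofReal_logDistortion [FiniteDimensional ℝ V] (P Q : InnerProd V) :
    edist P Q ≤ ENNReal.ofReal (Real.sqrt (Module.finrank ℝ V) * (2 * logDistortion P Q)) := by
  refine edist_le_of_form_le P Q (mul_nonneg zero_le_two (logDistortion_nonneg P Q)) (fun v => ?_)
    (form_le_exp_logDistortion_mul P Q)
  rw [logDistortion_comm]
  exact form_le_exp_logDistortion_mul Q P v

end OperatorNorm

/-! ### The `L²`-norm of functions with values in `[0, ∞]` -/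

section L2Norm

variable {Z : Type*} [MeasurableSpace Z]

/-- The `L²`-norm of a `[0, ∞]`-valued function, not necessarily measurable; the integral is then
the lower integral. -/
noncomputable def l2Norm (ν : Measure Z) (f : Z → ℝ≥0∞) : ℝ≥0∞ :=
  (∫⁻ z, f z ^ 2 ∂ν) ^ (1 / 2 : ℝ)

theorem l2Norm_mono {ν : Measure Z} {f h : Z → ℝ≥0∞} (hfh : ∀ z, f z ≤ h z) :
    l2Norm ν f ≤ l2Norm ν h :=
  ENNReal.rpow_le_rpow (lintegral_mono fun z => pow_le_pow_left' (hfh z) 2) (by norm_num)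

theorem l2Norm_add_le {ν : Measure Z} {f h : Z → ℝ≥0∞} (hf : Measurable f) (hh : Measurable h) :
    l2Norm ν (fun z => f z + h z) ≤ l2Norm ν f + l2Norm ν h := by
  have := ENNReal.lintegral_Lp_add_le (μ := ν) hf.aemeasurable hh.aemeasurable
    (p := 2) (by norm_num)
  simpa only [l2Norm, ENNReal.rpow_two, Pi.add_apply] using this

theorem l2Norm_const_mul {ν : Measure Z} {c : ℝ≥0∞} (hc : c ≠ ⊤) (f : Z → ℝ≥0∞) :
    l2Norm ν (fun z => c * f z) = c * l2Norm ν f := by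
  simp only [l2Norm, mul_pow]
  rw [lintegral_const_mul' _ _ (ENNReal.pow_ne_top hc), ENNReal.mul_rpow_of_nonneg _ _ (by norm_num)]
  congr 1
  rw [← ENNReal.rpow_two, ← ENNReal.rpow_mul]
  norm_num

theorem l2Norm_le_of_le {ν : Measure Z} [IsProbabilityMeasure ν] {f : Z → ℝ≥0∞} {c : ℝ≥0∞}
    (hf : ∀ z, f z ≤ c) : l2Norm ν f ≤ c := by
  refine (l2Norm_mono hf).trans (le_of_eq ?_)
  simp only [l2Norm, lintegral_const, measure_univ, mul_one]
  rw [← ENNReal.rpow_two, ← ENNReal.rpow_mul]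
  norm_num

theorem l2Norm_lt_iff {ν : Measure Z} {f : Z → ℝ≥0∞} {R : ℝ≥0∞} :
    l2Norm ν f < R ↔ ∫⁻ z, f z ^ 2 ∂ν < R ^ 2 := by
  have h : R = (R ^ 2) ^ (1 / 2 : ℝ) := by
    rw [← ENNReal.rpow_two, ← ENNReal.rpow_mul]
    norm_num
  conv_lhs => rw [h]
  exact ENNReal.rpow_lt_rpow_iff (by norm_num)

/-- The triangle inequality for an integrand that is a sum of two measurable functions and an
arbitrary one. -/
theorem l2Norm_le_add_add {ν : Measure Z} {f a b c : Z → ℝ≥0∞} (hf : Measurable f)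
    (ha : Measurable a) (hc : Measurable c) (h : ∀ z, f z ≤ a z + b z + c z) :
    l2Norm ν f ≤ l2Norm ν a + l2Norm ν b + l2Norm ν c := by
  have hac : Measurable fun z => a z + c z := ha.add hc
  -- the truncated difference `f - (a + c)` is a measurable function below `b`
  have hsub : ∀ z, f z - (a z + c z) ≤ b z := fun z => by
    rw [tsub_le_iff_left]
    exact (h z).trans_eq (by ring)
  calc l2Norm ν f ≤ l2Norm ν (fun z => (f z - (a z + c z)) + (a z + c z)) :=
        l2Norm_mono fun z => le_tsub_add
    _ ≤ l2Norm ν (fun z => f z - (a z + c z)) + l2Norm ν (fun z => a z + c z) :=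
        l2Norm_add_le (hf.sub hac) hac
    _ ≤ l2Norm ν b + (l2Norm ν a + l2Norm ν c) :=
        add_le_add (l2Norm_mono hsub) (l2Norm_add_le ha hc)
    _ = _ := by ring

end L2Norm

/-! ### The displacement of a Riemannian metric by a diffeomorphism -/

section Displacement

variable {n : ℕ} {N : Type*} [TopologicalSpace N] [ChartedSpace (EuclideanSpace ℝ (Fin n)) N]

/-- `D φ = (D φ⁻¹)⁻¹`, read in the model space because `φ (φ⁻¹ x)` and `x` are not definitionally
equal. -/
theorem diffD_apply_inv_eq_symm (φ : Diff n N) (x : N)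
    (v : TangentSpace (𝓡 n) (φ⁻¹ x)) :
    (diffD φ (φ⁻¹ x) v : EuclideanSpace ℝ (Fin n)) = (diffD φ⁻¹ x).symm v := by
  obtain ⟨w, rfl⟩ := (diffD φ⁻¹ x).surjective v
  rw [LinearEquiv.symm_apply_apply]
  have h := mfderiv_comp_apply (I := 𝓡 n) (I' := 𝓡 n) (I'' := 𝓡 n) x
    (φ.mdifferentiable (by simp) (φ⁻¹ x)) (φ⁻¹.mdifferentiable (by simp) x) w
  have hid : φ ∘ (φ⁻¹ : Diff n N) = id := funext fun y => φ.apply_symm_apply y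
  rw [hid, mfderiv_id] at h
  exact h.symm

variable [IsManifold (𝓡 n) (((⊤ : ℕ∞) : ℕ∞ω)) N]

/-- The pushforward `φ_* g`, as a field of inner products. -/
noncomputable def pushMetric (g : SmoothMetric n N) (φ : Diff n N) (x : N) :
    InnerProd (TangentSpace (𝓡 n) x) :=
  InnerProd.pullback (diffD φ⁻¹ x) (metricSection g (φ⁻¹ x))

/-- The pointwise distance of `g` and `φ_* g`. -/
noncomputable def displacement (g : SmoothMetric n N) (φ : Diff n N) (x : N) : ℝ≥0∞ :=
  edist (metricSection g x) (pushMetric g φ x)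

theorem displacement_ne_top (g : SmoothMetric n N) (φ : Diff n N) (x : N) :
    displacement g φ x ≠ ⊤ :=
  InnerProd.edist_ne_top _ _

theorem continuous_displacement (g : SmoothMetric n N) (φ : Diff n N) :
    Continuous (displacement g φ) :=
  IsContinuousMetric.continuous_edist (metricSection_mem g)
    (diffAction.map_contSections φ _ (metricSection_mem g))

theorem diffNorm_inv_eq (g : SmoothMetric n N) (φ : Diff n N) (x : N) :
    diffNorm g φ⁻¹ x = opNorm (metricSection g x) (pushMetric g φ x) LinearMap.id :=
  opNorm_eq_opNorm_pullback _ _ _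

theorem diffNorm_apply_inv_eq (g : SmoothMetric n N) (φ : Diff n N) (x : N) :
    diffNorm g φ (φ⁻¹ x) = opNorm (pushMetric g φ x) (metricSection g x) LinearMap.id := by
  refine Eq.trans ?_ (opNorm_symm_eq_opNorm_pullback (metricSection g x)
    (metricSection g (φ⁻¹ x)) (diffD φ⁻¹ x))
  -- `φ (φ⁻¹ x)` and `x` are equal, but not definitionally, so the target point is generalized
  have key : ∀ (y : N) (_ : y = x) (T : TangentSpace (𝓡 n) (φ⁻¹ x) →ₗ[ℝ] TangentSpace (𝓡 n) y)
      (_ : ∀ v, (T v : EuclideanSpace ℝ (Fin n)) = (diffD φ⁻¹ x).symm v),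
      opNorm (metricSection g (φ⁻¹ x)) (metricSection g y) T =
        opNorm (metricSection g (φ⁻¹ x)) (metricSection g x) (diffD φ⁻¹ x).symm.toLinearMap := by
    rintro y rfl T hT
    congr 1
    exact LinearMap.ext hT
  exact key _ (φ.apply_symm_apply x) _ (diffD_apply_inv_eq_symm φ x)

variable [MeasurableSpace N]

/-- The integrand of `d_{ν,g}(φ, 1)` at `x` is the log-distortion of the inner products `g` and
`φ_* g` on `T_x N`. -/
theorem diffDist_one_eq (ν : ProbabilityMeasure N) (g : SmoothMetric n N) (φ : Diff n N) :
    diffDist ν g φ 1 = l2Norm (ν : Measure N)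
      (fun x => ENNReal.ofReal (logDistortion (metricSection g x) (pushMetric g φ x))) := by
  unfold diffDist l2Norm
  congr 1
  refine lintegral_congr fun x => ?_
  rw [← ENNReal.ofReal_pow (logDistortion_nonneg _ _), logDistortion_comm, logDistortion,
    ← diffNorm_inv_eq, ← diffNorm_apply_inv_eq]
  simp only [inv_one, one_mul, mul_one, diff_one_apply]

theorem diffDist_one_le (ν : ProbabilityMeasure N) (g : SmoothMetric n N) (φ : Diff n N) :
    diffDist ν g φ 1 ≤ l2Norm (ν : Measure N) (displacement g φ) := by
  rw [diffDist_one_eq]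
  refine l2Norm_mono fun x => ?_
  refine ENNReal.ofReal_le_of_le_toReal ?_
  have h1 := two_mul_logDistortion_le (metricSection g x) (pushMetric g φ x)
  have h2 := logDistortion_nonneg (metricSection g x) (pushMetric g φ x)
  exact (by linarith : _ ≤ 2 * logDistortion (metricSection g x) (pushMetric g φ x)).trans h1

theorem l2Norm_displacement_le (ν : ProbabilityMeasure N) (g : SmoothMetric n N)
    (φ : Diff n N) :
    l2Norm (ν : Measure N) (displacement g φ) ≤
      ENNReal.ofReal (2 * Real.sqrt n) * diffDist ν g φ 1 := by
  rw [diffDist_one_eq, ← l2Norm_const_mul ENNReal.ofReal_ne_top]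
  refine l2Norm_mono fun x => ?_
  rw [← ENNReal.ofReal_mul (by positivity)]
  refine (edist_le_ofReal_logDistortion _ _).trans (ENNReal.ofReal_le_ofReal (le_of_eq ?_))
  have : Module.finrank ℝ (TangentSpace (𝓡 n) x) = n :=
    finrank_euclideanSpace_fin (𝕜 := ℝ) (n := n)
  rw [this]
  ring

end Displacement

/-! ### Coarse embeddings of groups -/

section Coarse

variable {G Y : Type*} [Group G] [EDist Y]

/-- A map `F` on a group with a proper left-invariant metric is a coarse embedding if the distance
of `F x` and `F x'` is bounded above by a function of `x⁻¹ x'` and tends to infinity with it. -/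
theorem isGroupCoarseEmbedding_of_finite {F : G → Y} {U : G → ℝ≥0∞} (hU : ∀ x, U x ≠ ⊤)
    (hFU : ∀ x x', edist (F x) (F x') ≤ U (x⁻¹ * x'))
    (hm : ∃ m : MetricSpace G, IsProperLeftInvariant m)
    (hfin : ∀ R : ℝ≥0, {x : G | ∃ y, edist (F y) (F (y * x)) < R}.Finite) :
    IsGroupCoarseEmbedding F := by
  refine ⟨hm, fun m hm => ?_⟩
  have hinv : ∀ x x' : G, nndist x x' = nndist 1 (x⁻¹ * x') := fun x x' => by
    have h := hm.1 x 1 (x⁻¹ * x')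
    rw [mul_one, mul_inv_cancel_left] at h
    exact Subtype.ext h
  have hball : ∀ r : ℝ≥0, {x : G | nndist 1 x ≤ r}.Finite := fun r =>
    (hm.2 r).subset fun x hx => by exact_mod_cast hx
  have hlow : ∀ r : ℝ≥0, min (r : ℝ≥0∞)
      (⨅ (x : G) (x' : G) (_ : r ≤ nndist x x'), edist (F x) (F x')) ≠ ⊤ := fun r =>
    ((min_le_left _ _).trans_lt ENNReal.coe_lt_top).ne
  have hup : ∀ r : ℝ≥0,
      (⨆ (x : G) (x' : G) (_ : nndist x x' ≤ r), edist (F x) (F x')) ≠ ⊤ := by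
    intro r
    have hsum : ∑ x ∈ (hball r).toFinset, U x < ⊤ :=
      ENNReal.sum_lt_top.2 fun x _ => (hU x).lt_top
    refine (lt_of_le_of_lt (iSup_le fun x => iSup_le fun x' => iSup_le fun h => ?_) hsum).ne
    refine (hFU x x').trans (Finset.single_le_sum (f := U) (fun _ _ => zero_le) ?_)
    rw [Set.Finite.mem_toFinset]
    exact (hinv x x').symm.le.trans h
  -- the infimum is over the empty set, hence `⊤`, for large `r` if `G` is finite: so it is cut off
  refine ⟨fun r => (min (r : ℝ≥0∞)
      (⨅ (x : G) (x' : G) (_ : r ≤ nndist x x'), edist (F x) (F x'))).toNNReal,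
    fun r => (⨆ (x : G) (x' : G) (_ : nndist x x' ≤ r), edist (F x) (F x')).toNNReal,
    fun r r' h => ?_, fun r r' h => ?_, ?_, fun x x' => ⟨?_, ?_⟩⟩
  · refine ENNReal.toNNReal_mono (hlow r') (min_le_min (by exact_mod_cast h) ?_)
    exact iInf_mono fun x => iInf_mono fun x' => iInf_mono' fun h' => ⟨h.trans h', le_rfl⟩
  · refine ENNReal.toNNReal_mono (hup r') ?_
    exact iSup_mono fun x => iSup_mono fun x' => iSup_mono' fun h' => ⟨h'.trans h, le_rfl⟩
  · refine tendsto_atTop.2 fun b => ?_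
    obtain ⟨r₀, hr₀⟩ : ∃ r₀ : ℝ≥0, ∀ x ∈ {x : G | ∃ y, edist (F y) (F (y * x)) < b},
        nndist 1 x ≤ r₀ := by
      obtain ⟨r₀, h⟩ := ((hfin b).image fun x => nndist 1 x).bddAbove
      exact ⟨r₀, fun x hx => h (mem_image_of_mem _ hx)⟩
    filter_upwards [eventually_ge_atTop b, eventually_gt_atTop r₀] with r hb hr
    refine ENNReal.le_toNNReal_of_coe_le ?_ (hlow r)
    refine le_min (by exact_mod_cast hb) ?_
    refine le_iInf fun x => le_iInf fun x' => le_iInf fun h => ?_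
    by_contra! hlt
    refine absurd (hr₀ (x⁻¹ * x') ⟨x, by rwa [mul_inv_cancel_left]⟩) (not_le.2 ?_)
    rw [← hinv]
    exact hr.trans_le h
  · rw [ENNReal.coe_toNNReal (hlow _)]
    exact (min_le_right _ _).trans (iInf_le_of_le x (iInf_le_of_le x' (iInf_le _ le_rfl)))
  · rw [ENNReal.coe_toNNReal (hup _)]
    exact le_iSup_of_le x (le_iSup_of_le x' (le_iSup_of_le le_rfl le_rfl))

/-- The lower control function of a coarse embedding makes it move points apart uniformly. -/
theorem IsGroupCoarseEmbedding.finite {F : G → Y} (hF : IsGroupCoarseEmbedding F) (R : ℝ≥0) :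
    {x : G | ∃ y, edist (F y) (F (y * x)) < R}.Finite := by
  obtain ⟨⟨m, hm⟩, h⟩ := hF
  obtain ⟨ρ, _, -, -, hρ, hlow⟩ := h m hm
  obtain ⟨r₀, hr₀⟩ := (tendsto_atTop.1 hρ R).exists_forall_of_atTop
  refine (hm.2 r₀).subset ?_
  rintro x ⟨y, hy⟩
  have h1 := ((hlow y (y * x)).1.trans_lt hy)
  by_contra! hx
  have hdist : m.dist y (y * x) = m.dist 1 x := by simpa using hm.1 y 1 x
  have h2 : r₀ ≤ nndist y (y * x) := by
    have : (r₀ : ℝ) ≤ dist y (y * x) := by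
      simp only [mem_ofPred_eq, not_le] at hx
      exact (hdist ▸ hx).le
    exact_mod_cast this
  exact absurd (hr₀ _ h2) (not_le.2 (by exact_mod_cast h1))

/-- A finite left-invariant pseudodistance becomes a left-invariant metric when the discrete metric
is added to it. -/
theorem exists_isProperLeftInvariant {D : G → G → ℝ≥0∞} (hD : ∀ x y, D x y ≠ ⊤)
    (hself : ∀ x, D x x = 0) (hcomm : ∀ x y, D x y = D y x)
    (htri : ∀ x y z, D x z ≤ D x y + D y z) (hinv : ∀ g x y, D (g * x) (g * y) = D x y)
    (hfin : ∀ R : ℝ≥0, {x : G | D 1 x < R}.Finite) :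
    ∃ m : MetricSpace G, IsProperLeftInvariant m := by
  classical
  let m : MetricSpace G :=
    { dist := fun x y => (D x y).toReal + if x = y then 0 else 1
      dist_self := fun x => by simp [hself]
      dist_comm := fun x y => by simp only [hcomm x y, eq_comm]
      dist_triangle := fun x y z => by
        have h1 : (D x z).toReal ≤ (D x y).toReal + (D y z).toReal := by
          rw [← ENNReal.toReal_add (hD x y) (hD y z)]
          exact ENNReal.toReal_mono (ENNReal.add_ne_top.2 ⟨hD x y, hD y z⟩) (htri x y z)
        have h2 : (if x = z then (0 : ℝ) else 1) ≤
            (if x = y then 0 else 1) + if y = z then 0 else 1 := by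
          split_ifs <;> simp_all
        linarith
      eq_of_dist_eq_zero := fun {x y} h => by
        by_contra hxy
        have h0 : 0 ≤ (D x y).toReal := ENNReal.toReal_nonneg
        have h : (D x y).toReal + (if x = y then 0 else 1) = 0 := h
        rw [if_neg hxy] at h
        linarith }
  have hm : ∀ x y, m.dist x y = (D x y).toReal + if x = y then 0 else 1 := fun _ _ => rfl
  refine ⟨m, fun g x y => ?_, fun r => ?_⟩
  · simp only [hm, hinv, mul_right_inj]
  · refine (hfin (r.toNNReal + 1)).subset fun x hx => ?_
    have hx : m.dist 1 x ≤ r := hx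
    rw [hm] at hx
    have h0 : (0 : ℝ) ≤ if (1 : G) = x then 0 else 1 := by split_ifs <;> norm_num
    change D 1 x < _
    rw [← ENNReal.ofReal_toReal (hD 1 x)]
    have h1 : (D 1 x).toReal ≤ r := by linarith
    refine (ENNReal.ofReal_le_ofReal h1).trans_lt ?_
    exact ENNReal.coe_lt_coe.2 (lt_add_of_pos_right _ one_pos)

end Coarse

/-! ### Weak continuity of integrals over a compact space -/

section Weak

variable {Z : Type*} [TopologicalSpace Z]

theorem exists_forall_le_of_continuous [CompactSpace Z] {f : Z → ℝ≥0∞} (hf : Continuous f)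
    (htop : ∀ z, f z ≠ ⊤) : ∃ C : ℝ≥0, ∀ z, f z ≤ C := by
  rcases isEmpty_or_nonempty Z with h | h
  · exact ⟨0, fun z => h.elim z⟩
  obtain ⟨z₀, -, hz₀⟩ := isCompact_univ.exists_isMaxOn univ_nonempty hf.continuousOn
  exact ⟨(f z₀).toNNReal, fun z => by
    rw [ENNReal.coe_toNNReal (htop z₀)]
    exact hz₀ (mem_univ z)⟩

variable [MeasurableSpace Z] [OpensMeasurableSpace Z]

/-- A finite continuous function on a compact space is bounded, so that weak convergence applies. -/
theorem continuous_lintegral_of_ne_top [CompactSpace Z] {f : Z → ℝ≥0∞} (hf : Continuous f)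
    (htop : ∀ z, f z ≠ ⊤) :
    Continuous fun ν : ProbabilityMeasure Z => ∫⁻ z, f z ∂(ν : Measure Z) := by
  let f' : BoundedContinuousFunction Z ℝ≥0 := BoundedContinuousFunction.mkOfCompact
    ⟨fun z => (f z).toNNReal, continuous_iff_continuousAt.2 fun z =>
      (ENNReal.tendsto_toNNReal (htop z)).comp hf.continuousAt⟩
  have hff : ∀ z, f z = (f' z : ℝ≥0∞) := fun z => (ENNReal.coe_toNNReal (htop z)).symm
  simp only [hff]
  exact continuous_iff_continuousAt.2 fun ν =>
    ProbabilityMeasure.tendsto_iff_forall_lintegral_tendsto.1 tendsto_id f'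

theorem continuous_l2Norm_of_ne_top [CompactSpace Z] {f : Z → ℝ≥0∞} (hf : Continuous f)
    (htop : ∀ z, f z ≠ ⊤) :
    Continuous fun ν : ProbabilityMeasure Z => l2Norm (ν : Measure Z) f :=
  ENNReal.continuous_rpow_const.comp (continuous_lintegral_of_ne_top (f := fun z => f z ^ 2)
    ((ENNReal.continuous_pow 2).comp hf) fun z => ENNReal.pow_ne_top (htop z))

end Weak

/-! ### Distances of square integrable sections -/

section L2Sections

variable {n : ℕ} {N : Type*} [TopologicalSpace N] [ChartedSpace (EuclideanSpace ℝ (Fin n)) N]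
  [IsManifold (𝓡 n) (((⊤ : ℕ∞) : ℕ∞ω)) N]

theorem secDist_ne_top (s t : ∀ z, (riem n N).Fiber z) (z : N) :
    (riem n N).secDist s t z ≠ ⊤ :=
  InnerProd.edist_ne_top (V := TangentSpace (𝓡 n) z) (s z) (t z)

theorem secDist_triangle (s t u : ∀ z, (riem n N).Fiber z) (z : N) :
    (riem n N).secDist s u z ≤ (riem n N).secDist s t z + (riem n N).secDist t u z :=
  InnerProd.edist_triangle' (V := TangentSpace (𝓡 n) z) (s z) (t z) (u z)

theorem secDist_comm (s t : ∀ z, (riem n N).Fiber z) :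
    (riem n N).secDist s t = (riem n N).secDist t s :=
  funext fun z => edist_comm (α := InnerProd (TangentSpace (𝓡 n) z)) (s z) (t z)

theorem continuous_secDist {s t : ∀ z, (riem n N).Fiber z}
    (hs : s ∈ (riem n N).contSections) (ht : t ∈ (riem n N).contSections) :
    Continuous ((riem n N).secDist s t) :=
  IsContinuousMetric.continuous_edist hs ht

variable [MeasurableSpace N]

theorem measurable_secDist_of_isL2 {ν : Measure N} {s t : ∀ z, (riem n N).Fiber z}
    (hs : s ∈ (riem n N).contSections) (ht : (riem n N).IsL2 ν t) :
    Measurable ((riem n N).secDist s t) :=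
  ht.1 s (mem_insert_of_mem _ hs) t (mem_insert _ _)

variable [BorelSpace N]

/-- The quadrangle inequality in `L²(N, ν, Riem(N))`, the outer two points being continuous
sections. The pointwise distance of the inner two points is not assumed to be measurable. -/
theorem edist_toL2_le_add_add {ν : Measure N} {s t : ∀ z, (riem n N).Fiber z}
    (hs : s ∈ (riem n N).contSections) (ht : t ∈ (riem n N).contSections)
    (x y : (riem n N).L2 ν) :
    l2Norm ν ((riem n N).secDist s t) ≤
      edist ((riem n N).toL2 s (isL2_of_mem_contSections hs ν)) x + edist x y +
        edist y ((riem n N).toL2 t (isL2_of_mem_contSections ht ν)) := by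
  induction x using Quotient.inductionOn with | _ x
  induction y using Quotient.inductionOn with | _ y
  refine l2Norm_le_add_add (b := (riem n N).secDist x.1 y.1) (continuous_secDist hs ht).measurable
    (measurable_secDist_of_isL2 hs x.2) ?_ fun z => ?_
  · rw [secDist_comm]
    exact measurable_secDist_of_isL2 ht y.2
  · exact (secDist_triangle s y.1 t z).trans (add_le_add_left (secDist_triangle s x.1 y.1 z) _)

theorem edist_toL2_ne_top [CompactSpace N] {ν : Measure N} [IsProbabilityMeasure ν]
    {s : ∀ z, (riem n N).Fiber z} (hs : s ∈ (riem n N).contSections) (x : (riem n N).L2 ν) :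
    edist x ((riem n N).toL2 s (isL2_of_mem_contSections hs ν)) ≠ ⊤ := by
  induction x using Quotient.inductionOn with | _ x
  obtain ⟨x, hx⟩ := x
  obtain ⟨hmeas, t, ht, hint⟩ := id hx
  obtain ⟨C, hC⟩ := exists_forall_le_of_continuous (continuous_secDist ht hs) (secDist_ne_top t s)
  have hxt : l2Norm ν ((riem n N).secDist x t) < ⊤ :=
    ENNReal.rpow_lt_top_of_nonneg (by norm_num) hint.ne
  have hmeas' : Measurable ((riem n N).secDist x t) := by
    rw [secDist_comm]
    exact measurable_secDist_of_isL2 ht hx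
  change l2Norm ν ((riem n N).secDist x s) ≠ ⊤
  refine ne_of_lt (((l2Norm_mono (secDist_triangle x t s)).trans
    (l2Norm_add_le hmeas' (continuous_secDist ht hs).measurable)).trans_lt ?_)
  exact ENNReal.add_lt_top.2 ⟨hxt, (l2Norm_le_of_le hC).trans_lt ENNReal.coe_lt_top⟩

/-- A continuous section of `Riem(N)`, as a section of `Riem(N)|_Y`. -/
noncomputable def diagonalSection (Y : Set (ProbabilityMeasure N))
    {s : ∀ z, (riem n N).Fiber z} (hs : s ∈ (riem n N).contSections) (ν : Y) :
    (riem n N).L2 (ν.1 : Measure N) :=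
  (riem n N).toL2 s (isL2_of_mem_contSections hs _)

theorem diagonalSection_mem_diagonal (Y : Set (ProbabilityMeasure N))
    {s : ∀ z, (riem n N).Fiber z} (hs : s ∈ (riem n N).contSections) :
    diagonalSection Y hs ∈ (riem n N).diagonal Y :=
  ⟨s, hs, fun _ => ⟨isL2_of_mem_contSections hs _, rfl⟩⟩

theorem diagonalSection_mem_contSections [CompactSpace N] (Y : Set (ProbabilityMeasure N))
    {s : ∀ z, (riem n N).Fiber z} (hs : s ∈ (riem n N).contSections) :
    diagonalSection Y hs ∈ ((riem n N).overProb Y).contSections := by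
  intro a ha b hb
  rw [insert_eq_of_mem (diagonalSection_mem_diagonal Y hs)] at ha hb
  obtain ⟨t, ht, hat⟩ := ha
  obtain ⟨u, hu, hbu⟩ := hb
  refine ((continuous_l2Norm_of_ne_top (continuous_secDist ht hu) (secDist_ne_top t u)).comp
    continuous_subtype_val).congr fun ν => ?_
  obtain ⟨h1, h2⟩ := hat ν
  obtain ⟨h3, h4⟩ := hbu ν
  rw [h2, h4]
  rfl

end L2Sections

/-! ### Properness of the induced actions -/

section Properness

variable {n : ℕ} {N : Type*} [TopologicalSpace N] [ChartedSpace (EuclideanSpace ℝ (Fin n)) N]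
  [MeasurableSpace N]

theorem orbit_subset_orbitHull [BorelSpace N] (Γ : Subgroup (Diff n N)) (μ : ProbabilityMeasure N) :
    orbit Γ μ ⊆ orbitHull Γ μ := fun _ hν =>
  subset_closure (subset_convexHull ℝ≥0 _ (mem_image_of_mem
    (fun ν : ProbabilityMeasure N => (ν : Measure N)) hν))

variable [IsManifold (𝓡 n) (((⊤ : ℕ∞) : ℕ∞ω)) N]

/-- Over a set `Y` of probability measures, the group elements move `g` uniformly far away from
itself: for each `R`, only finitely many `γ` satisfy `d(g, γ g) < R` in `L²(N, ν, Riem(N))` for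
some `ν` in `Y`. -/
def MovesMetric (Γ : Subgroup (Diff n N)) (g : SmoothMetric n N)
    (Y : Set (ProbabilityMeasure N)) : Prop :=
  ∀ R : ℝ≥0, {γ : Γ | ∃ ν ∈ Y, l2Norm (ν : Measure N) (displacement g γ) < R}.Finite

theorem MovesMetric.mono {Γ : Subgroup (Diff n N)} {g : SmoothMetric n N}
    {Y Y' : Set (ProbabilityMeasure N)} (h : MovesMetric Γ g Y') (hY : Y ⊆ Y') :
    MovesMetric Γ g Y := fun R =>
  (h R).subset fun _ ⟨ν, hν, hlt⟩ => ⟨ν, hY hν, hlt⟩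

variable [BorelSpace N]

/-- Only the comparability of `d_{ν,g}(γ, 1)` with the `L²(ν)`-distance of `g` and `γ g` matters,
with constants that do not depend on `ν` and `γ`. -/
theorem muDiscrete_iff (Γ : Subgroup (Diff n N)) (μ : ProbabilityMeasure N)
    (g : SmoothMetric n N) : MuDiscrete Γ μ g ↔ MovesMetric Γ g (orbit Γ μ) := by
  constructor
  · intro h R
    refine (h R).subset ?_
    rintro γ ⟨_, ⟨τ, hτ, rfl⟩, hlt⟩
    rw [mem_ofPred_eq, iInf_lt_iff]
    exact ⟨⟨τ, hτ⟩, (diffDist_one_le _ g γ).trans_lt hlt⟩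
  · intro h R
    refine (h ((2 * Real.sqrt n).toNNReal * R + 1)).subset ?_
    intro γ hγ
    rw [mem_ofPred_eq, iInf_lt_iff] at hγ
    obtain ⟨τ, hτ⟩ := hγ
    refine ⟨_, ⟨τ, τ.2, rfl⟩, (l2Norm_displacement_le _ g γ).trans_lt ?_⟩
    calc ENNReal.ofReal (2 * Real.sqrt n) * diffDist (pushMeasure (τ : Diff n N) μ) g γ 1
        ≤ ENNReal.ofReal (2 * Real.sqrt n) * R := by gcongr
      _ = (((2 * Real.sqrt n).toNNReal * R : ℝ≥0) : ℝ≥0∞) := by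
          rw [ENNReal.coe_mul]; rfl
      _ < _ := ENNReal.coe_lt_coe.2 (lt_add_of_pos_right _ one_pos)

/-- The infimum of `ν ↦ ∫ d(g, γ g)² dν` over the closed convex hull of an orbit is the infimum over
the orbit, since this function is affine and continuous. -/
theorem MovesMetric.orbitHull [CompactSpace N] {Γ : Subgroup (Diff n N)}
    {μ : ProbabilityMeasure N} {g : SmoothMetric n N} (h : MovesMetric Γ g (orbit Γ μ)) :
    MovesMetric Γ g (orbitHull Γ μ) := by
  intro R
  refine (h R).subset ?_
  rintro γ ⟨ν, hν, hlt⟩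
  by_contra! hge
  have hge : ∀ ν ∈ orbit Γ μ, (R : ℝ≥0∞) ^ 2 ≤ ∫⁻ x, displacement g γ x ^ 2 ∂(ν : Measure N) :=
    fun ν hν => not_lt.1 fun hlt => hge ⟨ν, hν, l2Norm_lt_iff.2 hlt⟩
  refine absurd (l2Norm_lt_iff.1 hlt) (not_lt.2 ?_)
  have hcont := continuous_lintegral_of_ne_top (f := fun z => displacement g γ z ^ 2)
    ((ENNReal.continuous_pow 2).comp (continuous_displacement g γ))
    fun z => ENNReal.pow_ne_top (displacement_ne_top g γ z)
  refine closure_minimal (t := {ν : ProbabilityMeasure N |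
    (R : ℝ≥0∞) ^ 2 ≤ ∫⁻ x, displacement g γ x ^ 2 ∂(ν : Measure N)}) ?_
    (isClosed_le continuous_const hcont) hν
  intro ν' hν'
  refine convexHull_min (t := {m : Measure N |
    (R : ℝ≥0∞) ^ 2 ≤ ∫⁻ x, displacement g γ x ^ 2 ∂m}) ?_ ?_ hν'
  · rintro _ ⟨ν₀, hν₀, rfl⟩
    exact hge ν₀ hν₀
  · intro m₁ h₁ m₂ h₂ a b _ _ hab
    change _ ≤ ∫⁻ x, displacement g γ x ^ 2 ∂(a • m₁ + b • m₂)
    rw [lintegral_add_measure, lintegral_smul_measure, lintegral_smul_measure]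
    calc (R : ℝ≥0∞) ^ 2 = a • (R : ℝ≥0∞) ^ 2 + b • (R : ℝ≥0∞) ^ 2 := by
          rw [← add_smul, hab, one_smul]
      _ ≤ _ := add_le_add (smul_le_smul_of_nonneg_left h₁ zero_le)
          (smul_le_smul_of_nonneg_left h₂ zero_le)

/-- The induced action over a closed invariant set `Y` is metrically proper if and only if the
displacement of the diagonal section `g` tends to infinity uniformly over `Y`: by compactness of
`Prob(N)`, any other continuous section is at bounded distance from the diagonal one. -/
theorem metricallyProper_overProb_iff [CompactSpace N] [T2Space N] (Γ : Subgroup (Diff n N))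
    (g : SmoothMetric n N) {Y : Set (ProbabilityMeasure N)} (hYc : IsClosed Y)
    (hY : ∀ γ : Γ, ∀ ν ∈ Y, (diffAction.restrict Γ).push γ ν ∈ Y) :
    ((diffAction.restrict Γ).overProb Y hY).MetricallyProper ↔ MovesMetric Γ g Y := by
  set α := (diffAction.restrict Γ).overProb Y hY with hα
  set S₀ := diagonalSection Y (metricSection_mem g) with hS₀
  constructor
  · intro h R
    refine (h S₀ (diagonalSection_mem_contSections Y _) R).subset ?_
    rintro γ ⟨ν, hν, hlt⟩
    rw [mem_ofPred_eq, iInf_lt_iff]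
    exact ⟨⟨ν, hν⟩, hlt⟩
  · intro h S hS R
    have : CompactSpace Y := isCompact_iff_compactSpace.1 hYc.isCompact
    obtain ⟨C, hC⟩ := exists_forall_le_of_continuous (Z := Y)
      (hS S (mem_insert _ _) S₀
        (mem_insert_of_mem _ (diagonalSection_mem_diagonal Y (metricSection_mem g))))
      (fun ν => edist_toL2_ne_top (metricSection_mem g) (S ν))
    refine (h (C + R + C + 1)).subset fun γ hγ => ?_
    rw [mem_ofPred_eq, iInf_lt_iff] at hγ
    obtain ⟨ν, hν⟩ := hγ
    refine ⟨ν.1, ν.2, ?_⟩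
    have hact : edist (α.act γ S ν) (α.act γ S₀ ν) ≤ C :=
      (α.isometry γ ν _ _).trans_le (hC (α.base γ ν))
    have hsymm : edist (S₀ ν) (S ν) ≤ C := by
      refine le_trans (le_of_eq ?_) (hC ν)
      change edist (S₀ ν) (S ν) = edist (S ν) (S₀ ν)
      generalize S ν = x
      induction x using Quotient.inductionOn with | _ x
      change l2Norm _ ((riem n N).secDist _ _) = l2Norm _ ((riem n N).secDist _ _)
      rw [secDist_comm]
    have hquad : l2Norm (ν.1 : Measure N) (displacement g γ) ≤
        edist (S₀ ν) (S ν) + edist (S ν) (α.act γ S ν) + edist (α.act γ S ν) (α.act γ S₀ ν) :=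
      edist_toL2_le_add_add (metricSection_mem g)
        (diffAction.map_contSections (γ : Diff n N) _ (metricSection_mem g)) (S ν) (α.act γ S ν)
    calc l2Norm (ν.1 : Measure N) (displacement g γ)
        ≤ C + R + C := hquad.trans (add_le_add (add_le_add hsymm hν.le) hact)
      _ = ((C + R + C : ℝ≥0) : ℝ≥0∞) := by push_cast; rfl
      _ < _ := ENNReal.coe_lt_coe.2 (lt_add_of_pos_right _ one_pos)

end Properness

/-! ### The orbit map of the metric -/

section Orbit

variable {n : ℕ} {N : Type*} [TopologicalSpace N] [ChartedSpace (EuclideanSpace ℝ (Fin n)) N]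
  [IsManifold (𝓡 n) (((⊤ : ℕ∞) : ℕ∞ω)) N]

/-- Left translation by `φ` preserves the distance of `x_* s` and `y_* s`, up to moving the point. -/
theorem secDist_act_mul (φ x y : Diff n N) (s : ∀ z, (riem n N).Fiber z) :
    (riem n N).secDist (diffAction.act (φ * x) s) (diffAction.act (φ * y) s) =
      (riem n N).secDist (diffAction.act x s) (diffAction.act y s) ∘ (φ⁻¹ : Diff n N) := by
  rw [diffAction.act_mul, diffAction.act_mul, diffAction.secDist_act]
  rfl

theorem secDist_act_act_mul (φ x : Diff n N) (s : ∀ z, (riem n N).Fiber z) :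
    (riem n N).secDist (diffAction.act φ s) (diffAction.act (φ * x) s) =
      (riem n N).secDist s (diffAction.act x s) ∘ (φ⁻¹ : Diff n N) := by
  rw [diffAction.act_mul, diffAction.secDist_act]
  rfl

/-- The uniform distance of `x_* g` and `y_* g`. -/
noncomputable def supDist (g : SmoothMetric n N) (x y : Diff n N) : ℝ≥0∞ :=
  ⨆ z, (riem n N).secDist (diffAction.act x (metricSection g))
    (diffAction.act y (metricSection g)) z

theorem supDist_mul (g : SmoothMetric n N) (φ x y : Diff n N) :
    supDist g (φ * x) (φ * y) = supDist g x y := by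
  refine (congrArg (fun f : N → ℝ≥0∞ => ⨆ z, f z) (secDist_act_mul φ x y (metricSection g))).trans ?_
  exact (diffAction.baseHomeo φ).surjective.iSup_comp (g := (riem n N).secDist
    (diffAction.act x (metricSection g)) (diffAction.act y (metricSection g)))

theorem supDist_ne_top [CompactSpace N] (g : SmoothMetric n N) (x y : Diff n N) :
    supDist g x y ≠ ⊤ := by
  obtain ⟨C, hC⟩ := exists_forall_le_of_continuous
    (continuous_secDist (diffAction.map_contSections x _ (metricSection_mem g))
      (diffAction.map_contSections y _ (metricSection_mem g))) (secDist_ne_top _ _)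
  exact ((iSup_le hC).trans_lt ENNReal.coe_lt_top).ne

variable [MeasurableSpace N] [BorelSpace N]

/-- The distance of `τ g` and `τ φ g` in `L²(μ)` is that of `g` and `φ g` in `L²(τ⁻¹ μ)`. -/
theorem edist_translate (μ : ProbabilityMeasure N) (g : SmoothMetric n N) (τ φ : Diff n N) :
    edist (translate μ g τ) (translate μ g (τ * φ)) =
      l2Norm (pushMeasure τ⁻¹ μ : Measure N) (displacement g φ) := by
  refine (congrArg (l2Norm (μ : Measure N)) (secDist_act_act_mul τ φ (metricSection g))).trans ?_
  unfold l2Norm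
  congr 1
  exact (lintegral_map ((continuous_displacement g φ).measurable.pow_const 2)
    (τ⁻¹ : Diff n N).continuous.measurable).symm

theorem edist_translate_le_supDist (μ : ProbabilityMeasure N) (g : SmoothMetric n N)
    (x y : Diff n N) : edist (translate μ g x) (translate μ g y) ≤ supDist g x y :=
  l2Norm_le_of_le fun z => le_iSup ((riem n N).secDist (diffAction.act x (metricSection g))
    (diffAction.act y (metricSection g))) z

theorem exists_edist_translate_lt_iff (Γ : Subgroup (Diff n N)) (μ : ProbabilityMeasure N)
    (g : SmoothMetric n N) (R : ℝ≥0) (γ : Γ) :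
    (∃ τ : Γ, edist (translate μ g τ) (translate μ g (τ * γ : Γ)) < R) ↔
      ∃ ν ∈ orbit Γ μ, l2Norm (ν : Measure N) (displacement g γ) < R := by
  constructor
  · rintro ⟨τ, hτ⟩
    exact ⟨_, ⟨_, Γ.inv_mem τ.2, rfl⟩, (edist_translate μ g τ γ).symm.trans_lt hτ⟩
  · rintro ⟨_, ⟨τ, hτ, rfl⟩, hlt⟩
    refine ⟨⟨τ⁻¹, Γ.inv_mem hτ⟩, (edist_translate μ g τ⁻¹ γ).trans_lt ?_⟩
    rwa [inv_inv]

/-- The numbers `d(τ g, τ γ g)` in `L²(N, μ, Riem(N))` are the displacements of `g` over the orbit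
of `μ`, by `edist_translate`. When these tend to infinity, `Γ` is countable: the uniform distance on
the translates of `g` provides a proper left-invariant metric. -/
theorem isGroupCoarseEmbedding_iff [CompactSpace N] (Γ : Subgroup (Diff n N))
    (μ : ProbabilityMeasure N) (g : SmoothMetric n N) :
    IsGroupCoarseEmbedding (fun γ : Γ => translate μ g γ) ↔ MovesMetric Γ g (orbit Γ μ) := by
  constructor
  · intro h R
    exact (h.finite R).subset fun γ hγ => (exists_edist_translate_lt_iff Γ μ g R γ).2 hγ
  · intro h
    have hfin : ∀ R : ℝ≥0,
        {γ : Γ | ∃ τ : Γ, edist (translate μ g τ) (translate μ g (τ * γ : Γ)) < R}.Finite :=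
      fun R => (h R).subset fun γ hγ => (exists_edist_translate_lt_iff Γ μ g R γ).1 hγ
    refine isGroupCoarseEmbedding_of_finite (U := fun γ : Γ => supDist g 1 γ)
      (fun γ => supDist_ne_top g 1 γ) (fun x y => ?_) ?_ hfin
    · refine (edist_translate_le_supDist μ g x y).trans_eq ?_
      rw [← supDist_mul g (x : Diff n N)⁻¹, inv_mul_cancel]
      rfl
    · refine exists_isProperLeftInvariant (D := fun x y : Γ => supDist g x y)
        (fun x y => supDist_ne_top g x y) (fun x => ?_) (fun x y => ?_) (fun x y z => ?_)
        (fun φ x y => supDist_mul g φ x y) fun R => ?_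
      · exact iSup_eq_bot.2 fun z => InnerProd.edist_self' (V := TangentSpace (𝓡 n) z) _
      · simp only [supDist]
        rw [secDist_comm]
      · refine iSup_le fun w => (secDist_triangle _
          (diffAction.act (y : Diff n N) (metricSection g)) _ w).trans (add_le_add ?_ ?_)
        · exact le_iSup ((riem n N).secDist _ _) w
        · exact le_iSup ((riem n N).secDist _ _) w
      · refine (hfin R).subset fun γ hγ => ⟨1, ?_⟩
        rw [one_mul]
        exact (edist_translate_le_supDist μ g _ _).trans_lt hγ

end Orbit

end RiemField

theorem mainTheorem3 {n : ℕ} {N : Type*} [TopologicalSpace N]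
    [ChartedSpace (EuclideanSpace ℝ (Fin n)) N]
    [IsManifold (𝓡 n) (((⊤ : ℕ∞) : ℕ∞ω)) N] [CompactSpace N] [T2Space N]
    [MeasurableSpace N] [BorelSpace N]
    (Γ : Subgroup (RiemField.Diff n N)) (μ : ProbabilityMeasure N)
    (g : RiemField.SmoothMetric n N) :
    List.TFAE [RiemField.MuDiscrete Γ μ g,
      (RiemField.orbitClosureAction Γ μ).MetricallyProper,
      (RiemField.orbitHullAction Γ μ).MetricallyProper,
      RiemField.IsGroupCoarseEmbedding (fun γ : Γ => RiemField.translate μ g γ)] := by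
  have h1 := RiemField.muDiscrete_iff Γ μ g
  have h2 := RiemField.metricallyProper_overProb_iff Γ g isClosed_closure
    (RiemField.orbitClosure_invariant Γ μ)
  have h3 := RiemField.metricallyProper_overProb_iff Γ g isClosed_closure
    (RiemField.orbitHull_invariant Γ μ)
  have h4 := RiemField.isGroupCoarseEmbedding_iff Γ μ g
  tfae_have 1 → 3 := fun h => h3.2 (h1.1 h).orbitHull
  tfae_have 3 → 2 := fun h => h2.2 ((h3.1 h).mono
    (closure_minimal (RiemField.orbit_subset_orbitHull Γ μ) isClosed_closure))
  tfae_have 2 → 1 := fun h => h1.2 ((h2.1 h).mono subset_closure)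
  tfae_have 1 ↔ 4 := h1.trans h4.symm
  tfae_finish
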